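/- Let $A$ be a commutative ring with unit, let $R$ be a commutative $A$-algebra, let $n\ge 1$, and let $F$ be a free $A$-module of rank $n$ with a distinguished element $e$ that is part of a basis of $F$. Let $\mathcal{H}ilb^n_{R/A}$ be the functor from commutative $A$-algebras to sets that sends $B$ to the set of surjective $B$-algebra homomorphisms $B\otimes_A R\to Q$, where $Q$ is a locally free $B$-module of rank $n$ (two such surjections being identified when they have the same kernel, that is, when they differ by an isomorphism of their targets), and that sends $B\to C$ to $(B\otimes_AR\to Q)\mapsto (C\otimes_AR\to C\otimes_BQ)$. For an $A$-module homomorphism $\beta:F\to R$ with $\beta(e)=1$, let $\mathcal{H}ilb^\beta_{R/A}\subseteq\mathcal{H}ilb^n_{R/A}$ be the subfunctor of those $B\otimes_AR\to Q$ for which the composite $B\otimes_AF\xrightarrow{\mathrm{id}\otimes\beta}B\otimes_AR\to Q$ is surjective. Notation. For a homomorphism $u:N\to P$ of modules over a ring $B$, with $P$ free of finite rank, let $\mathfrak I_Z(u)\subseteq B$ be the ideal of zeroes of $u$, that is, the image of $N\otimes_B P^\vee\to P\otimes_B P^\vee\xrightarrow{\mathrm{ev}}B$; for an element $p\in P$ let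 $\mathfrak I_Z(p)$ be that of the map $B\to P$, $1\mapsto p$. Let $M$ be an $A$-module and $\pi:\operatorname{Sym}_A(M)\to R$ a surjective $A$-algebra homomorphism with kernel $\mathfrak I$ (every $R$ has such presentations, for example with $M=R$). Let $S=\operatorname{Sym}_A(M\otimes_A\operatorname{End}_A(F)^\vee)$, let $t\in\operatorname{End}_A(F)^\vee\otimes_A\operatorname{End}_A(F)$ be the element corresponding to the identity of $\operatorname{End}_A(F)$, and let $\mu:S\otimes_AM\to S\otimes_A\operatorname{End}_A(F)$ be the $S$-linear map with $\mu(1\otimes x)=x\otimes t$. (a) Let $H$ be the quotient of $S$ by the ideal generated by all $\mathfrak I_Z\bigl(\mu(1\otimes x)\mu(1\otimes y)-\mu(1\otimes y)\mu(1\otimes x)\bigr)$, $x,y\in M$, and let $\mu_H:H\otimes_A\operatorname{Sym}_A(M)\to H\otimes_A\operatorname{End}_A(F)$ be the $H$-algebra homomorphism for which $\mu_H(1\otimes x)$ is the image of $\mu(1\otimes x)$, for all $x\in M$. (b) Let $H_R=H/\mathfrak I_Z(v)$, where $v$ is the composite $H\otimes_A\mathfrak I\to H\otimes_A\operatorname{Sym}_A(M)\xrightarrow{\mu_H}H\otimes_A\operatorname{End}_A(F)$,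 and let $\mu_{H_R}:H_R\otimes_AR\to H_R\otimes_A\operatorname{End}_A(F)$ be the $H_R$-algebra homomorphism induced by $\mu_H$. (c) For $\beta:F\to R$ with $\beta(e)=1$ let $H_R^\beta=H_R/\mathfrak I_Z(\mathrm{id}-u)$, where $u$ is the composite $H_R\otimes_AF\xrightarrow{\mathrm{id}\otimes\beta}H_R\otimes_AR\xrightarrow{\mu_{H_R}}H_R\otimes_A\operatorname{End}_A(F)\xrightarrow{\mathrm{id}\otimes\mathrm{ev}_e}H_R\otimes_AF$ with $\mathrm{ev}_e(w)=w(e)$, and let $\mu_{H_R^\beta}:H_R^\beta\otimes_AR\to H_R^\beta\otimes_AF$ be the composite of the base change of $\mu_{H_R}$ to $H_R^\beta$ with $\mathrm{id}\otimes\mathrm{ev}_e$. **Theorem.** 1. The functor $\mathcal{H}ilb^n_{R/A}$ is representable: there is a scheme $X$ over $\operatorname{Spec}(A)$ with isomorphisms $\operatorname{Hom}_{\operatorname{Spec}(A)}(\operatorname{Spec}(B),X)\cong\mathcal{H}ilb^n_{R/A}(B)$ that are natural in the $A$-algebra $B$. 2. The subfunctors $\mathcal{H}ilb^\beta_{R/A}$,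 for all $A$-module homomorphisms $\beta:F\to R$ with $\beta(e)=1$, form an open covering of $\mathcal{H}ilb^n_{R/A}$. That is, for each $\beta$, each $B$ and each $x\in\mathcal{H}ilb^n_{R/A}(B)$ there is an open subset $U\subseteq\operatorname{Spec}(B)$ such that for every homomorphism of $A$-algebras $B\to C$ the image of $x$ lies in $\mathcal{H}ilb^\beta_{R/A}(C)$ if and only if $\operatorname{Spec}(C)\to\operatorname{Spec}(B)$ has its image in $U$; and for each $B$, each $x\in\mathcal{H}ilb^n_{R/A}(B)$ and each prime ideal $\mathfrak p$ of $B$ there are $f\in B\setminus\mathfrak p$ and $\beta$ such that the image of $x$ in $\mathcal{H}ilb^n_{R/A}(B_f)$ lies in $\mathcal{H}ilb^\beta_{R/A}(B_f)$. 3. For every presentation $\pi$ and every $\beta$ as above, the map $\mu_{H_R^\beta}:H_R^\beta\otimes_AR\to H_R^\beta\otimes_AF$ is surjective, its kernel is an ideal, it takes $1\otimes1$ to $1\otimes e$, and its composite with $\mathrm{id}\otimes\beta$ is the identity of $H_R^\beta\otimes_AF$; and there is a natural isomorphism of functors $\operatorname{Hom}_{A\text{-alg}}(H_R^\beta,-)\to\mathcal{H}ilb^\beta_{R/A}$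 that maps $\mathrm{id}_{H_R^\beta}$ to the class of $\mu_{H_R^\beta}$. That is, $\mathcal{H}ilb^\beta_{R/A}$ is represented by the $A$-algebra $H_R^\beta$ with universal family $\mu_{H_R^\beta}$. -/

import Mathlib

open CategoryTheory TensorProduct

universe u

namespace HilbertPoints

noncomputable section

/-! ### Locally free modules of rank `n` -/

/-- `Q` is a locally free `B`-module of rank `n`: every prime of `B` has a basic open
neighbourhood `D(f)` on which `B_f ⊗ Q` is free of rank `n` over `B_f`. -/
def IsLocallyFreeOfRank (B : Type*) [CommRing B] (Q : Type*) [AddCommGroup Q] [Module B Q]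
    (n : ℕ) : Prop :=
  ∀ p : PrimeSpectrum B, ∃ f : B, f ∉ p.asIdeal ∧
    Nonempty ((Localization.Away f ⊗[B] Q) ≃ₗ[Localization.Away f] (Fin n → Localization.Away f))

theorem IsLocallyFreeOfRank.congr {B : Type*} [CommRing B] {Q Q' : Type*} [AddCommGroup Q]
    [Module B Q] [AddCommGroup Q'] [Module B Q'] {n : ℕ} (h : IsLocallyFreeOfRank B Q n)
    (e : Q ≃ₗ[B] Q') : IsLocallyFreeOfRank B Q' n := by
  intro p
  obtain ⟨f, hf, ⟨g⟩⟩ := h p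
  exact ⟨f, hf, ⟨(e.baseChange B (Localization.Away f) Q Q').symm ≪≫ₗ g⟩⟩

theorem IsLocallyFreeOfRank.baseChange {B : Type*} [CommRing B] {Q : Type*} [AddCommGroup Q]
    [Module B Q] {n : ℕ} (h : IsLocallyFreeOfRank B Q n) (C : Type*) [CommRing C] [Algebra B C] :
    IsLocallyFreeOfRank C (C ⊗[B] Q) n := by
  intro p
  obtain ⟨f, hf, ⟨g⟩⟩ := h (PrimeSpectrum.comap (algebraMap B C) p)
  refine ⟨algebraMap B C f, hf, ?_⟩
  let _ : Algebra (Localization.Away f) (Localization.Away (algebraMap B C f)) :=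
    (Localization.awayMap (algebraMap B C) f).toAlgebra
  have : IsScalarTower B (Localization.Away f) (Localization.Away (algebraMap B C f)) := by
    refine IsScalarTower.of_algebraMap_eq fun x => ?_
    rw [RingHom.algebraMap_toAlgebra, Localization.awayMap, IsLocalization.Away.map,
      IsLocalization.map_eq, ← IsScalarTower.algebraMap_apply B C]
  exact ⟨AlgebraTensorModule.cancelBaseChange B C _ _ Q ≪≫ₗ
    (AlgebraTensorModule.cancelBaseChange B (Localization.Away f) _ _ Q).symm ≪≫ₗ
    g.baseChange (Localization.Away f) (Localization.Away (algebraMap B C f)) _ _ ≪≫ₗ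
    TensorProduct.piScalarRight _ _ _ _⟩

/-! ### The Hilbert functor of `n` points -/

section Hilb

variable {A : Type u} [CommRing A] (R : Type u) [CommRing R] [Algebra A R]

/-- The ring homomorphism `φ ⊗ id_R : B ⊗ R → C ⊗ R`. -/
abbrev baseMap {B C : Type*} [CommRing B] [CommRing C] [Algebra A B] [Algebra A C]
    (φ : B →ₐ[A] C) : B ⊗[A] R →ₐ[A] C ⊗[A] R :=
  Algebra.TensorProduct.map φ (AlgHom.id A R)

/-- Base change of quotients of `B ⊗ R`: for a quotient `Q = (B ⊗ R)/I`, the `C`-algebra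
`C ⊗_B Q` is the quotient of `C ⊗ R` by the ideal generated by the image of `I`. -/
theorem nonempty_quotient_equiv {B C : Type*} [CommRing B] [CommRing C] [Algebra A B]
    [Algebra A C] [Algebra B C] [IsScalarTower A B C] (I : Ideal (B ⊗[A] R)) :
    Nonempty ((C ⊗[B] ((B ⊗[A] R) ⧸ I)) ≃ₐ[C]
      ((C ⊗[A] R) ⧸ I.map (baseMap R (IsScalarTower.toAlgHom A B C)))) := by
  let e := Algebra.TensorProduct.cancelBaseChange A B C C R
  let q : C ⊗[B] (B ⊗[A] R) →ₐ[C] C ⊗[B] ((B ⊗[A] R) ⧸ I) :=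
    Algebra.TensorProduct.map (AlgHom.id C C) (Ideal.Quotient.mkₐ B I)
  have hq : Function.Surjective q :=
    LinearMap.lTensor_surjective C (g := (Ideal.Quotient.mkₐ B I).toLinearMap)
      (Ideal.Quotient.mkₐ_surjective B I)
  have hker : RingHom.ker q = I.map
      (Algebra.TensorProduct.includeRight : B ⊗[A] R →ₐ[B] C ⊗[B] (B ⊗[A] R)) := by
    have := Algebra.TensorProduct.lTensor_ker (A := C) (Ideal.Quotient.mkₐ B I)
      (Ideal.Quotient.mkₐ_surjective B I)
    have h0 : RingHom.ker (Ideal.Quotient.mkₐ B I) = I := Ideal.Quotient.mkₐ_ker B I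
    rw [h0] at this
    exact this
  let f : C ⊗[A] R →ₐ[C] C ⊗[B] ((B ⊗[A] R) ⧸ I) := q.comp e.symm.toAlgHom
  have hf : Function.Surjective f := hq.comp e.symm.surjective
  have hfk : RingHom.ker f = I.map (baseMap R (IsScalarTower.toAlgHom A B C)) := by
    have h1 : RingHom.ker f = (RingHom.ker q).comap (e.symm : C ⊗[A] R ≃+* _) := rfl
    rw [h1, hker, ← Ideal.map_symm]
    change Ideal.map (RingHomClass.toRingHom e) (Ideal.map (RingHomClass.toRingHom
      (Algebra.TensorProduct.includeRight : B ⊗[A] R →ₐ[B] C ⊗[B] (B ⊗[A] R))) I) =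
      Ideal.map (baseMap R (IsScalarTower.toAlgHom A B C)).toRingHom I
    rw [Ideal.map_map]
    congr 1
    refine RingHom.ext fun x => ?_
    induction x with
    | zero => simp
    | tmul b r => simp [e, Algebra.smul_def]
    | add x y hx hy => rw [map_add, map_add, hx, hy]
  exact ⟨(Ideal.quotientKerAlgEquivOfSurjective hf).symm.trans (Ideal.quotientEquivAlgOfEq C hfk)⟩

/-- A `B`-point of the Hilbert functor of `n` points of `R` over `A`: a surjective `B`-algebra
homomorphism `B ⊗ R → Q` with `Q` locally free of rank `n`. Two surjections that differ by an
isomorphism of the targets are the same point, so a point is given by the kernel. -/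
@[ext]
structure HilbPoint (n : ℕ) (B : Type u) [CommRing B] [Algebra A B] where
  ideal : Ideal (B ⊗[A] R)
  isLocallyFree : IsLocallyFreeOfRank B ((B ⊗[A] R) ⧸ ideal) n

variable {R} in
/-- The image of a point under `φ : B → C`: the surjection `B ⊗ R → Q` is sent to
`C ⊗ R = C ⊗_B (B ⊗ R) → C ⊗_B Q`. -/
def HilbPoint.map {n : ℕ} {B C : Type u} [CommRing B] [CommRing C] [Algebra A B] [Algebra A C]
    (φ : B →ₐ[A] C) (x : HilbPoint (A := A) R n B) : HilbPoint (A := A) R n C where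
  ideal := x.ideal.map (baseMap R φ)
  isLocallyFree := by
    let _ : Algebra B C := φ.toRingHom.toAlgebra
    have : IsScalarTower A B C := IsScalarTower.of_algebraMap_eq fun r => (φ.commutes r).symm
    obtain ⟨e⟩ := nonempty_quotient_equiv (A := A) R (C := C) x.ideal
    exact (x.isLocallyFree.baseChange C).congr e.toLinearEquiv

theorem HilbPoint.map_id {n : ℕ} {B : Type u} [CommRing B] [Algebra A B]
    (x : HilbPoint (A := A) R n B) : x.map (AlgHom.id A B) = x := by
  refine HilbPoint.ext ?_
  change Ideal.map (baseMap R (AlgHom.id A B)) x.ideal = x.ideal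
  rw [baseMap, Algebra.TensorProduct.map_id]
  exact Ideal.map_id x.ideal

theorem HilbPoint.map_comp {n : ℕ} {B C D : Type u} [CommRing B] [CommRing C] [CommRing D]
    [Algebra A B] [Algebra A C] [Algebra A D] (φ : B →ₐ[A] C) (ψ : C →ₐ[A] D)
    (x : HilbPoint (A := A) R n B) : x.map (ψ.comp φ) = (x.map φ).map ψ := by
  refine HilbPoint.ext ?_
  change Ideal.map (baseMap R (ψ.comp φ)).toRingHom x.ideal =
    Ideal.map (baseMap R ψ).toRingHom (Ideal.map (baseMap R φ).toRingHom x.ideal)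
  rw [Ideal.map_map]
  congr 1
  refine RingHom.ext fun y => ?_
  induction y with
  | zero => simp
  | tmul b r => simp
  | add x y hx hy => rw [RingHom.map_add, RingHom.map_add, hx, hy]

variable (A) in
/-- The Hilbert functor of `n` points of `R` over `A`, on commutative `A`-algebras. -/
def hilb (n : ℕ) : CommAlgCat.{u} A ⥤ Type u where
  obj B := HilbPoint (A := A) R n B
  map φ := ↾fun x => x.map φ.hom
  map_id B := by
    ext x : 3
    exact HilbPoint.map_id R x
  map_comp φ ψ := by
    ext x : 3
    exact HilbPoint.map_comp R φ.hom ψ.hom x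

variable {R} {F : Type u} [AddCommGroup F] [Module A F]

/-- The composite `B ⊗ F → B ⊗ R → (B ⊗ R)/I` of `id_B ⊗ β` with the residue map. -/
def sectionMap (β : F →ₗ[A] R) (B : Type u) [CommRing B] [Algebra A B] (I : Ideal (B ⊗[A] R)) :
    B ⊗[A] F →ₗ[B] (B ⊗[A] R) ⧸ I :=
  (Ideal.Quotient.mkₐ B I).toLinearMap ∘ₗ β.baseChange B

theorem sectionMap_map_surjective (β : F →ₗ[A] R) {B C : Type u} [CommRing B] [CommRing C]
    [Algebra A B] [Algebra A C] (φ : B →ₐ[A] C) (I : Ideal (B ⊗[A] R))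
    (h : Function.Surjective (sectionMap β B I)) :
    Function.Surjective (sectionMap β C (I.map (baseMap R φ))) := by
  rw [← LinearMap.range_eq_top, eq_top_iff]
  rintro y -
  obtain ⟨y, rfl⟩ := Ideal.Quotient.mk_surjective y
  induction y with
  | zero => rw [map_zero]; exact zero_mem _
  | add x y hx hy => rw [map_add]; exact add_mem hx hy
  | tmul c r =>
    obtain ⟨z, hz⟩ := h (Ideal.Quotient.mk I (1 ⊗ₜ r))
    have hz' : β.baseChange B z - 1 ⊗ₜ r ∈ I := Ideal.Quotient.eq.mp hz
    have h1 : ∀ z : B ⊗[A] F, baseMap R φ (β.baseChange B z) =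
        β.baseChange C (φ.toLinearMap.rTensor F z) := by
      intro z
      induction z with
      | zero => simp
      | tmul b f => simp
      | add x y hx hy => rw [map_add, map_add, map_add, map_add, hx, hy]
    have h2 := Ideal.mem_map_of_mem (baseMap R φ) hz'
    rw [map_sub, h1] at h2
    have h3 := Ideal.Quotient.eq.mpr h2
    refine ⟨c • φ.toLinearMap.rTensor F z, ?_⟩
    rw [map_smul]
    change c • Ideal.Quotient.mk _ (β.baseChange C (φ.toLinearMap.rTensor F z)) = _
    rw [h3]
    change Ideal.Quotient.mk _ (c • baseMap R φ (1 ⊗ₜ r)) = _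
    simp [TensorProduct.smul_tmul']

/-- The subfunctor of the Hilbert functor attached to `β : F → R`: the points `B ⊗ R → Q` such
that `B ⊗ F → B ⊗ R → Q` is surjective. -/
def hilbSection (n : ℕ) (β : F →ₗ[A] R) : Subfunctor (hilb A R n) where
  obj B := {x : HilbPoint (A := A) R n B | Function.Surjective (sectionMap β B x.ideal)}
  map φ := fun x hx => sectionMap_map_surjective β φ.hom x.ideal hx

end Hilb

/-! ### Open subfunctors, open coverings and points of a scheme -/

section Open

variable {A : Type u} [CommRing A] {H : CommAlgCat.{u} A ⥤ Type u}

/-- `G ⊆ H` is an open subfunctor: for every `x ∈ H(B)` there is an open `U ⊆ Spec B` such that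
a homomorphism `φ : B → C` takes `x` into `G(C)` if and only if `Spec C → Spec B` factors
through `U`. -/
def IsOpenSubfunctor (G : Subfunctor H) : Prop :=
  ∀ (B : CommAlgCat.{u} A) (x : H.obj B), ∃ U : TopologicalSpace.Opens (PrimeSpectrum B),
    ∀ (C : CommAlgCat.{u} A) (φ : B ⟶ C),
      H.map φ x ∈ G.obj C ↔
        Set.range (PrimeSpectrum.comap (φ.hom : B →+* C)) ⊆ (U : Set (PrimeSpectrum B))

/-- The localization homomorphism `B → B_f` in the category of `A`-algebras. -/
def awayHom (B : CommAlgCat.{u} A) (f : B) : B ⟶ CommAlgCat.of A (Localization.Away f) :=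
  CommAlgCat.ofHom (IsScalarTower.toAlgHom A B (Localization.Away f))

/-- The `G i` form an open covering of `H`: they are open subfunctors, and for every `x ∈ H(B)`
every prime of `B` has a basic open neighbourhood `D(f)` such that the restriction of `x` to
`D(f)` lies in some `G i`. -/
def IsOpenCovering {ι : Type*} (G : ι → Subfunctor H) : Prop :=
  (∀ i, IsOpenSubfunctor (G i)) ∧
    ∀ (B : CommAlgCat.{u} A) (x : H.obj B) (p : PrimeSpectrum B),
      ∃ f : B, f ∉ p.asIdeal ∧ ∃ i,
        H.map (awayHom B f) x ∈ (G i).obj (CommAlgCat.of A (Localization.Away f))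

/-- The functor of points `B ↦ Hom_{Spec A}(Spec B, X)` of a scheme `X` over `Spec A`, on
`A`-algebras. -/
def pointsFunctor (X : Over (AlgebraicGeometry.Spec (CommRingCat.of A))) :
    CommAlgCat.{u} A ⥤ Type u :=
  (AlgebraicGeometry.algSpec (CommRingCat.of A)).rightOp ⋙ yoneda.obj X

/-- `H` is represented by a scheme over `Spec A`. -/
def IsRepresentableByScheme (H : CommAlgCat.{u} A ⥤ Type u) : Prop :=
  ∃ X : Over (AlgebraicGeometry.Spec (CommRingCat.of A)), Nonempty (pointsFunctor X ≅ H)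

end Open

/-! ### The functors of homomorphisms -/

section Hom

variable {A : Type u} [CommRing A]

/-- The `B`-module homomorphism `u : B ⊗ R → B ⊗ F` belongs to `Hom^β_B(R, F)`: it is surjective,
its kernel is an ideal, `u(1 ⊗ 1) = 1 ⊗ e`, and `u ∘ (id_B ⊗ β)` is the identity. -/
structure IsSectionHom {R F : Type u} [CommRing R] [Algebra A R] [AddCommGroup F] [Module A F]
    (e : F) (β : F →ₗ[A] R) {B : Type u} [CommRing B] [Algebra A B]
    (u : B ⊗[A] R →ₗ[B] B ⊗[A] F) : Prop where
  surjective : Function.Surjective u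
  ker_isIdeal : ∃ I : Ideal (B ⊗[A] R), I.restrictScalars B = LinearMap.ker u
  map_one : u (1 ⊗ₜ 1) = 1 ⊗ₜ e
  comp_section : u ∘ₗ β.baseChange B = LinearMap.id

/-- The point `x` is the class of the surjection `u : B ⊗ R → B ⊗ F`, that is, the ideal of `x`
is the kernel of `u`. -/
def HilbPoint.IsClassOf {R F : Type u} [CommRing R] [Algebra A R] [AddCommGroup F] [Module A F]
    {n : ℕ} {B : Type u} [CommRing B] [Algebra A B] (x : HilbPoint (A := A) R n B)
    (u : B ⊗[A] R →ₗ[B] B ⊗[A] F) : Prop :=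
  x.ideal.restrictScalars B = LinearMap.ker u

/-- For `φ : B → C` and a `B`-linear `u : B ⊗ M → B ⊗ N`, the `C`-linear map
`C ⊗ M → C ⊗ N` obtained by base change. -/
def homMap {M N : Type*} [AddCommGroup M] [Module A M] [AddCommGroup N] [Module A N]
    {B C : Type*} [CommRing B] [CommRing C] [Algebra A B] [Algebra A C] (φ : B →ₐ[A] C)
    (u : B ⊗[A] M →ₗ[B] B ⊗[A] N) : C ⊗[A] M →ₗ[C] C ⊗[A] N :=
  LinearMap.liftBaseChange C
    (φ.toLinearMap.rTensor N ∘ₗ u.restrictScalars A ∘ₗ TensorProduct.mk A B M 1)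

/-- An `A`-algebra homomorphism `R → C ⊗ E` extended to a `C`-algebra homomorphism
`C ⊗ R → C ⊗ E`. -/
def algLift {R E : Type*} [CommRing R] [Algebra A R] [Ring E] [Algebra A E]
    {C : Type*} [CommRing C] [Algebra A C] (g : R →ₐ[A] C ⊗[A] E) : C ⊗[A] R →ₐ[C] C ⊗[A] E :=
  Algebra.TensorProduct.lift (Algebra.ofId C (C ⊗[A] E)) g
    fun c x => (Algebra.commute_algebraMap_left c (g x) :)

theorem algLift_tmul {R E : Type*} [CommRing R] [Algebra A R] [Ring E] [Algebra A E]
    {C : Type*} [CommRing C] [Algebra A C] (g : R →ₐ[A] C ⊗[A] E) (c : C) (r : R) :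
    algLift g (c ⊗ₜ r) = c • g r := by
  rw [Algebra.smul_def]
  exact Algebra.TensorProduct.lift_tmul _ _ _ _ _

/-- For `φ : B → C` and a `B`-algebra homomorphism `u : B ⊗ R → B ⊗ E`, the `C`-algebra
homomorphism `C ⊗ R → C ⊗ E` obtained by base change. -/
def homAlgMap {R E : Type*} [CommRing R] [Algebra A R] [Ring E] [Algebra A E]
    {B C : Type*} [CommRing B] [CommRing C] [Algebra A B] [Algebra A C] (φ : B →ₐ[A] C)
    (u : B ⊗[A] R →ₐ[B] B ⊗[A] E) : C ⊗[A] R →ₐ[C] C ⊗[A] E :=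
  algLift (((Algebra.TensorProduct.map φ (AlgHom.id A E)).comp (u.restrictScalars A)).comp
    Algebra.TensorProduct.includeRight)

/-- The ideal of zeroes of `u : N → P`: the image of `N ⊗ P^∨ → P ⊗ P^∨ → A`. -/
def zeroIdeal {N P : Type*} [AddCommGroup N] [Module A N] [AddCommGroup P] [Module A P]
    (u : N →ₗ[A] P) : Ideal A :=
  LinearMap.range (contractRight A P ∘ₗ u.rTensor (Module.Dual A P))

theorem apply_mem_zeroIdeal {N P : Type*} [AddCommGroup N] [Module A N] [AddCommGroup P]
    [Module A P] (u : N →ₗ[A] P) (x : N) (ξ : Module.Dual A P) : ξ (u x) ∈ zeroIdeal u :=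
  ⟨x ⊗ₜ ξ, by simp⟩

/-- If the ideal of zeroes of `u : N → B ⊗ E` is killed by `φ : B → C`, then `u` composed with
`B ⊗ E → C ⊗ E` is zero. -/
theorem map_eq_zero_of_zeroIdeal_le {E : Type*} [AddCommGroup E] [Module A E] [Module.Free A E]
    {B C : Type*} [CommRing B] [CommRing C] [Algebra A B] [Algebra A C]
    (φ : B →ₐ[A] C) {N : Type*} [AddCommGroup N] [Module B N] (u : N →ₗ[B] B ⊗[A] E)
    (h : zeroIdeal u ≤ RingHom.ker φ) (x : N) : φ.toLinearMap.rTensor E (u x) = 0 := by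
  let b := Module.Free.chooseBasis A E
  let b' := b.baseChange B
  rw [← b'.linearCombination_repr (u x), Finsupp.linearCombination_apply, Finsupp.sum, map_sum]
  refine Finset.sum_eq_zero fun i _ => ?_
  have hi : φ (b'.repr (u x) i) = 0 := h (apply_mem_zeroIdeal u x (b'.coord i))
  simp [b', TensorProduct.smul_tmul', hi]

end Hom

/-! ### The algebras `H`, `H_R` and `H_R^β` -/

section Universal

/-- An `A`-linear map from `M` to an `A`-algebra with commuting values extends to the symmetric
algebra. -/
def symLift {A M E : Type*} [CommRing A] [AddCommGroup M] [Module A M] [Ring E] [Algebra A E]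
    (g : M →ₗ[A] E) (hg : ∀ x y, g x * g y = g y * g x) : SymmetricAlgebra A M →ₐ[A] E :=
  RingCon.liftₐ (TensorAlgebra.symRingCon A M) (TensorAlgebra.lift A g) (by
    refine RingCon.ringConGen_le.2 fun x y h => ?_
    cases h with
    | mul_comm x y => simpa [RingCon.ker_apply] using hg x y)

theorem symLift_ι {A M E : Type*} [CommRing A] [AddCommGroup M] [Module A M] [Ring E]
    [Algebra A E] (g : M →ₗ[A] E) (hg : ∀ x y, g x * g y = g y * g x) (x : M) :
    symLift g hg (SymmetricAlgebra.ι A M x) = g x :=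
  TensorAlgebra.lift_ι_apply g x

/-- An algebra homomorphism that vanishes on the kernel of the surjection `π` descends along
`π`. -/
def descend {A S R E : Type*} [CommRing A] [CommRing S] [Algebra A S] [CommRing R] [Algebra A R]
    [Ring E] [Algebra A E] (π : S →ₐ[A] R) (hπ : Function.Surjective π) (g : S →ₐ[A] E)
    (hg : ∀ x ∈ RingHom.ker π, g x = 0) : R →ₐ[A] E :=
  (Ideal.Quotient.liftₐ (RingHom.ker π) g hg).comp
    (Ideal.quotientKerAlgEquivOfSurjective hπ).symm.toAlgHom

theorem descend_apply {A S R E : Type*} [CommRing A] [CommRing S] [Algebra A S] [CommRing R]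
    [Algebra A R] [Ring E] [Algebra A E] (π : S →ₐ[A] R) (hπ : Function.Surjective π)
    (g : S →ₐ[A] E) (hg : ∀ x ∈ RingHom.ker π, g x = 0) (x : S) :
    descend π hπ g hg (π x) = g x := by
  have h : (Ideal.quotientKerAlgEquivOfSurjective hπ).symm (π x) =
      Ideal.Quotient.mk (RingHom.ker π) x :=
    Ideal.quotientKerAlgEquivOfSurjective_symm_apply hπ x
  change Ideal.Quotient.liftₐ (RingHom.ker π) g hg
    ((Ideal.quotientKerAlgEquivOfSurjective hπ).symm (π x)) = g x
  rw [h]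
  rfl

variable (A : Type u) [CommRing A] (F : Type u) [AddCommGroup F] [Module A F]
  [Module.Free A F] [Module.Finite A F] (M : Type u) [AddCommGroup M] [Module A M]

/-- The element `t(1)` of `End(F)^∨ ⊗ End(F)`, dual to the evaluation map; it corresponds to the
identity of `End(F)`. -/
def coevEnd : Module.Dual A (Module.End A F) ⊗[A] Module.End A F :=
  (dualTensorHomEquiv A (Module.End A F) (Module.End A F)).symm LinearMap.id

/-- The symmetric algebra `Sym_A(M ⊗ End_A(F)^∨)`. -/
abbrev SymEnd : Type u := SymmetricAlgebra A (M ⊗[A] Module.Dual A (Module.End A F))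

/-- The `A`-linear map `M → Sym_A(M ⊗ End_A(F)^∨) ⊗ End_A(F)`, `x ↦ x ⊗ t(1)`. -/
def muAux : M →ₗ[A] SymEnd A F M ⊗[A] Module.End A F :=
  (SymmetricAlgebra.ι A (M ⊗[A] Module.Dual A (Module.End A F))).rTensor (Module.End A F) ∘ₗ
    (TensorProduct.assoc A M (Module.Dual A (Module.End A F)) (Module.End A F)).symm.toLinearMap ∘ₗ
    (TensorProduct.mk A M (Module.Dual A (Module.End A F) ⊗[A] Module.End A F)).flip (coevEnd A F)

/-- The universal homomorphism
`μ : Sym_A(M ⊗ End_A(F)^∨) ⊗ M → Sym_A(M ⊗ End_A(F)^∨) ⊗ End_A(F)`. -/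
def mu : SymEnd A F M ⊗[A] M →ₗ[SymEnd A F M] SymEnd A F M ⊗[A] Module.End A F :=
  LinearMap.liftBaseChange (SymEnd A F M) (muAux A F M)

/-- The commutator `μ(1 ⊗ x) μ(1 ⊗ y) - μ(1 ⊗ y) μ(1 ⊗ x)`. -/
def muCommutator (x y : M) : SymEnd A F M ⊗[A] Module.End A F :=
  mu A F M (1 ⊗ₜ x) * mu A F M (1 ⊗ₜ y) - mu A F M (1 ⊗ₜ y) * mu A F M (1 ⊗ₜ x)

/-- The smallest ideal containing the ideals of zeroes of all the commutators. -/
def idealH : Ideal (SymEnd A F M) :=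
  ⨆ (x : M) (y : M), zeroIdeal (LinearMap.toSpanSingleton (SymEnd A F M)
    (SymEnd A F M ⊗[A] Module.End A F) (muCommutator A F M x y))

/-- The algebra `H`. -/
def AlgH : Type u := SymEnd A F M ⧸ idealH A F M

instance : CommRing (AlgH A F M) := inferInstanceAs (CommRing (SymEnd A F M ⧸ idealH A F M))

instance : Algebra A (AlgH A F M) := inferInstanceAs (Algebra A (SymEnd A F M ⧸ idealH A F M))

/-- The residue class homomorphism `ρ_H`. -/
def rhoH : SymEnd A F M →ₐ[A] AlgH A F M := Ideal.Quotient.mkₐ A (idealH A F M)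

theorem homMap_rhoH_commute (x y : M) :
    homMap (rhoH A F M) (mu A F M) (1 ⊗ₜ x) * homMap (rhoH A F M) (mu A F M) (1 ⊗ₜ y) =
      homMap (rhoH A F M) (mu A F M) (1 ⊗ₜ y) * homMap (rhoH A F M) (mu A F M) (1 ⊗ₜ x) := by
  have h := map_eq_zero_of_zeroIdeal_le (rhoH A F M)
    (LinearMap.toSpanSingleton (SymEnd A F M) (SymEnd A F M ⊗[A] Module.End A F)
      (muCommutator A F M x y)) (by
        refine le_trans (le_iSup₂_of_le x y le_rfl) (le_of_eq ?_ : idealH A F M ≤ _)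
        exact (Ideal.Quotient.mkₐ_ker A (idealH A F M)).symm) 1
  have h' : Algebra.TensorProduct.map (rhoH A F M) (AlgHom.id A (Module.End A F))
      (muCommutator A F M x y) = 0 := by
    rw [LinearMap.toSpanSingleton_apply, one_smul] at h
    exact h
  have key : ∀ z : M, homMap (rhoH A F M) (mu A F M) (1 ⊗ₜ z) =
      Algebra.TensorProduct.map (rhoH A F M) (AlgHom.id A (Module.End A F))
        (mu A F M (1 ⊗ₜ z)) := by
    intro z
    rw [homMap, LinearMap.liftBaseChange_tmul, one_smul]
    rfl
  rw [key, key, ← sub_eq_zero]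
  rw [muCommutator, map_sub, map_mul, map_mul] at h'
  exact h'

/-- The `H`-algebra homomorphism `μ_H : H ⊗ Sym_A(M) → H ⊗ End_A(F)` determined by
`μ_H(1 ⊗ x) = Hom_{ρ_H}(μ)(1 ⊗ x)` for `x ∈ M`. -/
def muH : AlgH A F M ⊗[A] SymmetricAlgebra A M →ₐ[AlgH A F M] AlgH A F M ⊗[A] Module.End A F :=
  algLift (symLift
    ((homMap (rhoH A F M) (mu A F M)).restrictScalars A ∘ₗ TensorProduct.mk A (AlgH A F M) M 1)
    (homMap_rhoH_commute A F M))

variable {A M} {R : Type u} [CommRing R] [Algebra A R] (π : SymmetricAlgebra A M →ₐ[A] R)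

/-- The composite `v : H ⊗ 𝔍 → H ⊗ Sym_A(M) → H ⊗ End_A(F)`, for `𝔍` the kernel of the
presentation `π : Sym_A(M) → R`. -/
def vMap : AlgH A F M ⊗[A] ((RingHom.ker π).restrictScalars A) →ₗ[AlgH A F M]
    AlgH A F M ⊗[A] Module.End A F :=
  (muH A F M).toLinearMap ∘ₗ ((RingHom.ker π).restrictScalars A).subtype.baseChange (AlgH A F M)

/-- The algebra `H_R`, for `R` presented by `π : Sym_A(M) → R`. -/
def AlgHR : Type u := AlgH A F M ⧸ zeroIdeal (vMap F π)

instance : CommRing (AlgHR F π) := inferInstanceAs (CommRing (AlgH A F M ⧸ zeroIdeal (vMap F π)))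

instance : Algebra A (AlgHR F π) :=
  inferInstanceAs (Algebra A (AlgH A F M ⧸ zeroIdeal (vMap F π)))

/-- The residue homomorphism `ρ_{H_R}`. -/
def rhoHR : AlgH A F M →ₐ[A] AlgHR F π := Ideal.Quotient.mkₐ A (zeroIdeal (vMap F π))

theorem homAlgMap_rhoHR_eq_zero (x : SymmetricAlgebra A M) (hx : x ∈ RingHom.ker π) :
    homAlgMap (rhoHR F π) (muH A F M) (1 ⊗ₜ x) = 0 := by
  have h := map_eq_zero_of_zeroIdeal_le (rhoHR F π) (vMap F π)
    (le_of_eq (Ideal.Quotient.mkₐ_ker A (zeroIdeal (vMap F π))).symm)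
    (1 ⊗ₜ (⟨x, hx⟩ : (RingHom.ker π).restrictScalars A))
  rw [homAlgMap, algLift_tmul, one_smul]
  exact h

/-- The `H_R`-algebra homomorphism `μ_{H_R} : H_R ⊗ R → H_R ⊗ End_A(F)` induced by
`Hom_{ρ_{H_R}}(μ_H)`. -/
def muHR (hπ : Function.Surjective π) :
    AlgHR F π ⊗[A] R →ₐ[AlgHR F π] AlgHR F π ⊗[A] Module.End A F :=
  let g : SymmetricAlgebra A M →ₐ[A] AlgHR F π ⊗[A] Module.End A F :=
    ((homAlgMap (rhoHR F π) (muH A F M)).restrictScalars A).comp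
      Algebra.TensorProduct.includeRight
  algLift (descend π hπ g fun x hx => homAlgMap_rhoHR_eq_zero F π x hx)

variable {F}

/-- The evaluation map `ev_e : End_A(F) → F`. -/
def evalAt (e : F) : Module.End A F →ₗ[A] F := LinearMap.applyₗ e

/-- The composite `u : H_R ⊗ F → H_R ⊗ R → H_R ⊗ End_A(F) → H_R ⊗ F`. -/
def uMap (hπ : Function.Surjective π) (e : F) (β : F →ₗ[A] R) :
    AlgHR F π ⊗[A] F →ₗ[AlgHR F π] AlgHR F π ⊗[A] F :=
  (evalAt e).baseChange (AlgHR F π) ∘ₗ (muHR F π hπ).toLinearMap ∘ₗ β.baseChange (AlgHR F π)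

/-- The algebra `H_R^β`. -/
def AlgHRSection (hπ : Function.Surjective π) (e : F) (β : F →ₗ[A] R) : Type u :=
  AlgHR F π ⧸ zeroIdeal (LinearMap.id - uMap π hπ e β)

instance (hπ : Function.Surjective π) (e : F) (β : F →ₗ[A] R) :
    CommRing (AlgHRSection π hπ e β) :=
  inferInstanceAs (CommRing (AlgHR F π ⧸ zeroIdeal (LinearMap.id - uMap π hπ e β)))

instance (hπ : Function.Surjective π) (e : F) (β : F →ₗ[A] R) :
    Algebra A (AlgHRSection π hπ e β) :=
  inferInstanceAs (Algebra A (AlgHR F π ⧸ zeroIdeal (LinearMap.id - uMap π hπ e β)))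

/-- The residue homomorphism `ρ_{H_R^β}`. -/
def rhoHRSection (hπ : Function.Surjective π) (e : F) (β : F →ₗ[A] R) :
    AlgHR F π →ₐ[A] AlgHRSection π hπ e β :=
  Ideal.Quotient.mkₐ A (zeroIdeal (LinearMap.id - uMap π hπ e β))

/-- The homomorphism `μ_{H_R^β} : H_R^β ⊗ R → H_R^β ⊗ End_A(F)`. -/
def muHRSection (hπ : Function.Surjective π) (e : F) (β : F →ₗ[A] R) :
    AlgHRSection π hπ e β ⊗[A] R →ₐ[AlgHRSection π hπ e β]
      AlgHRSection π hπ e β ⊗[A] Module.End A F :=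
  homAlgMap (rhoHRSection π hπ e β) (muHR F π hπ)

/-- The universal family `H_R^β ⊗ R → H_R^β ⊗ F`: the composite of `μ_{H_R^β}` with
`id ⊗ ev_e`. -/
def universalFamily (hπ : Function.Surjective π) (e : F) (β : F →ₗ[A] R) :
    AlgHRSection π hπ e β ⊗[A] R →ₗ[AlgHRSection π hπ e β] AlgHRSection π hπ e β ⊗[A] F :=
  (evalAt e).baseChange (AlgHRSection π hπ e β) ∘ₗ (muHRSection π hπ e β).toLinearMap

end Universal

end
end HilbertPoints

/-! A section `β` rigidifies a point `B ⊗ R → Q` of `Hilb^β`: the surjection `B ⊗ F → Q` between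
locally free modules of the same rank is an isomorphism, so that `Q` becomes an algebra structure
on `B ⊗ F`, and multiplication is a homomorphism `μ : R → B ⊗ End(F)` with `μ(β(f))(e) = f`.
Conversely, such a `μ` is recovered from the kernel of `r ↦ μ(r)(e)`. These homomorphisms are what
the algebra `H_R^β` classifies: a linear map `M → B ⊗ End(F)` is a point of
`Sym(M ⊗ End(F)^∨)`, it extends to `Sym(M)` over `H`, descends to `R` over `H_R`, and is compatible
with `β` over `H_R^β`.

The locus where `B ⊗ F → Q` is surjective is the complement of the support of its cokernel, hence
open. Over the residue field of a prime of `B`, the images of `R` span `Q`, and a family in `R` that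
starts with `1` and maps to a basis of `Q` is a `β` for which that prime lies in the locus.

The Hilbert functor is a Zariski sheaf. Inside the chart `Spec H_R^β`, the locus of another section
`γ` is where the determinant of `γ` followed by the universal family is invertible, so the charts
overlap in principal open sets. Whether two points of the charts define the same point of the
Hilbert functor is an equivalence relation, and the charts glue along it to a scheme that represents
the functor. -/

namespace HilbertPoints

noncomputable section

/-! ### Base change and locally free modules -/

section BaseChange

theorem exists_linearEquiv_of_ker_eq {B N P Q : Type*} [Ring B] [AddCommGroup N] [Module B N]
    [AddCommGroup P] [Module B P] [AddCommGroup Q] [Module B Q] {p : N →ₗ[B] P} {q : N →ₗ[B] Q}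
    (hp : Function.Surjective p) (hq : Function.Surjective q)
    (h : LinearMap.ker p = LinearMap.ker q) : ∃ σ : P ≃ₗ[B] Q, q = σ.toLinearMap ∘ₗ p :=
  ⟨(p.quotKerEquivOfSurjective hp).symm ≪≫ₗ Submodule.quotEquivOfEq _ _ h ≪≫ₗ
    q.quotKerEquivOfSurjective hq, LinearMap.ext fun x => by
      have hx : (p.quotKerEquivOfSurjective hp).symm (p x) = Submodule.Quotient.mk x := by
        rw [LinearEquiv.symm_apply_eq]
        rfl
      simp [hx]⟩

theorem rTensor_smul {A E B C : Type*} [CommRing A] [AddCommGroup E] [Module A E] [CommRing B]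
    [Algebra A B] [CommRing C] [Algebra A C] (φ : B →ₐ[A] C) (c : B) (y : B ⊗[A] E) :
    φ.toLinearMap.rTensor E (c • y) = φ c • φ.toLinearMap.rTensor E y := by
  induction y with
  | zero => simp
  | add x y hx hy => simp only [smul_add, map_add, hx, hy]
  | tmul b f => simp [smul_tmul']

variable {A : Type u} [CommRing A] {R : Type u} [CommRing R] [Algebra A R]

theorem baseMap_smul {B C : Type*} [CommRing B] [CommRing C] [Algebra A B] [Algebra A C]
    (φ : B →ₐ[A] C) (b : B) (z : B ⊗[A] R) : baseMap R φ (b • z) = φ b • baseMap R φ z :=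
  rTensor_smul φ b z

/-- The base change `C ⊗ R → C ⊗_B Q` of a `B`-linear map `q : B ⊗ R → Q`, with its source
rewritten along `C ⊗_B (B ⊗ R) = C ⊗ R`. -/
def quotMap {B : Type*} (C : Type*) [CommRing B] [CommRing C] [Algebra A B] [Algebra A C]
    [Algebra B C] [IsScalarTower A B C] {Q : Type*} [AddCommGroup Q] [Module B Q]
    (q : B ⊗[A] R →ₗ[B] Q) : C ⊗[A] R →ₗ[C] C ⊗[B] Q :=
  q.baseChange C ∘ₗ (AlgebraTensorModule.cancelBaseChange A B C C R).symm.toLinearMap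

theorem surjective_mk {B : Type*} [CommRing B] [Algebra A B] (I : Ideal (B ⊗[A] R)) :
    Function.Surjective (Ideal.Quotient.mkₐ B I).toLinearMap :=
  Ideal.Quotient.mkₐ_surjective B I

theorem ker_mk {B : Type*} [CommRing B] [Algebra A B] (I : Ideal (B ⊗[A] R)) :
    I.restrictScalars B = LinearMap.ker (Ideal.Quotient.mkₐ B I).toLinearMap :=
  Submodule.ext fun _ => Ideal.Quotient.eq_zero_iff_mem.symm

section quotMap

variable {B C : Type*} [CommRing B] [CommRing C] [Algebra A B] [Algebra A C]
  [Algebra B C] [IsScalarTower A B C] {Q : Type*} [AddCommGroup Q] [Module B Q]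
  (q : B ⊗[A] R →ₗ[B] Q)

theorem quotMap_tmul (c : C) (r : R) : quotMap C q (c ⊗ₜ r) = c ⊗ₜ q (1 ⊗ₜ r) := by
  simp [quotMap]

theorem quotMap_baseMap (z : B ⊗[A] R) :
    quotMap C q (baseMap R (IsScalarTower.toAlgHom A B C) z) = 1 ⊗ₜ q z := by
  induction z with
  | zero => simp
  | add x y hx hy => simp only [map_add, hx, hy, tmul_add]
  | tmul b r =>
    have h : b ⊗ₜ[A] r = b • ((1 : B) ⊗ₜ[A] r) := by simp [TensorProduct.smul_tmul']
    rw [Algebra.TensorProduct.map_tmul, quotMap_tmul, h, map_smul, tmul_smul, smul_tmul',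
      IsScalarTower.toAlgHom_apply, AlgHom.id_apply, Algebra.smul_def, mul_one]

theorem quotMap_surjective (hq : Function.Surjective q) : Function.Surjective (quotMap C q) :=
  (LinearMap.lTensor_surjective C hq).comp (LinearEquiv.surjective _)

theorem ker_quotMap_mk (I : Ideal (B ⊗[A] R)) :
    (I.map (baseMap R (IsScalarTower.toAlgHom A B C))).restrictScalars C =
      LinearMap.ker (quotMap C (Ideal.Quotient.mkₐ B I).toLinearMap) := by
  let e := Algebra.TensorProduct.cancelBaseChange A B C C R
  have hker : RingHom.ker (Algebra.TensorProduct.map (AlgHom.id C C) (Ideal.Quotient.mkₐ B I)) =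
      I.map (Algebra.TensorProduct.includeRight : B ⊗[A] R →ₐ[B] C ⊗[B] (B ⊗[A] R)) :=
    (Algebra.TensorProduct.lTensor_ker (A := C) (Ideal.Quotient.mkₐ B I)
      (Ideal.Quotient.mkₐ_surjective B I)).trans (congrArg _ (Ideal.Quotient.mkₐ_ker B I))
  have hbase : (e : C ⊗[B] (B ⊗[A] R) →+* C ⊗[A] R).comp
      (Algebra.TensorProduct.includeRight : B ⊗[A] R →ₐ[B] C ⊗[B] (B ⊗[A] R)).toRingHom =
        (baseMap R (IsScalarTower.toAlgHom A B C)).toRingHom := by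
    refine RingHom.ext fun x => ?_
    induction x with
    | zero => simp
    | tmul b r => simp [e, Algebra.smul_def]
    | add x y hx hy => rw [map_add, map_add, hx, hy]
  have hmap : I.map (baseMap R (IsScalarTower.toAlgHom A B C)) =
      (RingHom.ker (Algebra.TensorProduct.map (AlgHom.id C C) (Ideal.Quotient.mkₐ B I))).comap
        (e.symm : C ⊗[A] R ≃+* C ⊗[B] (B ⊗[A] R)) := by
    rw [hker, ← Ideal.map_symm]
    exact (congrArg (Ideal.map · I) hbase.symm).trans (Ideal.map_map _ _).symm
  rw [hmap]
  rfl

theorem ker_quotMap (hq : Function.Surjective q) (I : Ideal (B ⊗[A] R))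
    (hI : I.restrictScalars B = LinearMap.ker q) :
    (I.map (baseMap R (IsScalarTower.toAlgHom A B C))).restrictScalars C =
      LinearMap.ker (quotMap C q) := by
  obtain ⟨σ, hσ⟩ := exists_linearEquiv_of_ker_eq (surjective_mk I) hq ((ker_mk I).symm.trans hI)
  have hσ' : quotMap C q = (σ.baseChange B C _ _).toLinearMap ∘ₗ
      quotMap C (Ideal.Quotient.mkₐ B I).toLinearMap :=
    (congrArg (quotMap C) hσ).trans <| AlgebraTensorModule.ext fun c r => by
      simp only [LinearMap.comp_apply, quotMap_tmul]
      rfl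
  rw [ker_quotMap_mk, hσ', LinearEquiv.ker_comp]

end quotMap

theorem sectionMap_surjective_iff {F : Type u} [AddCommGroup F] [Module A F] (β : F →ₗ[A] R)
    {B : Type u} [CommRing B] [Algebra A B] (I : Ideal (B ⊗[A] R)) {W : Type*} [AddCommGroup W]
    [Module B W] (w : B ⊗[A] R →ₗ[B] W) (hw : Function.Surjective w)
    (hI : I.restrictScalars B = LinearMap.ker w) :
    Function.Surjective (sectionMap β B I) ↔ Function.Surjective (w ∘ₗ β.baseChange B) := by
  obtain ⟨σ, rfl⟩ := exists_linearEquiv_of_ker_eq (surjective_mk I) hw ((ker_mk I).symm.trans hI)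
  rw [LinearMap.comp_assoc, LinearMap.coe_comp]
  exact (σ.toEquiv.comp_surjective _).symm

section Away

variable {B C : Type*} [CommRing B] [CommRing C] [Algebra A B] [Algebra A C] [Algebra B C]
  [IsScalarTower A B C] (f : B) [IsLocalization.Away f C]

theorem mem_map_baseMap_away_iff (I : Ideal (B ⊗[A] R)) (z : B ⊗[A] R) :
    baseMap R (IsScalarTower.toAlgHom A B C) z ∈ I.map (baseMap R (IsScalarTower.toAlgHom A B C)) ↔
      ∃ k : ℕ, f ^ k • z ∈ I := by
  have h := IsLocalizedModule.eq_zero_iff (Submonoid.powers f)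
    (TensorProduct.mk B C ((B ⊗[A] R) ⧸ I) 1) (m := (Ideal.Quotient.mkₐ B I).toLinearMap z)
  rw [← Submodule.restrictScalars_mem C, ker_quotMap_mk, LinearMap.mem_ker, quotMap_baseMap,
    ← TensorProduct.mk_apply, h, Subtype.exists]
  simp only [Submonoid.mem_powers_iff, exists_prop, exists_exists_eq_and, Submonoid.mk_smul]
  exact exists_congr fun k => Ideal.Quotient.eq_zero_iff_mem

theorem exists_baseMap_eq_pow_smul (y : C ⊗[A] R) :
    ∃ (k : ℕ) (z : B ⊗[A] R), baseMap R (IsScalarTower.toAlgHom A B C) z =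
      algebraMap B C f ^ k • y := by
  induction y with
  | zero => exact ⟨0, 0, by simp⟩
  | tmul c r =>
    obtain ⟨k, b, h⟩ := IsLocalization.Away.surj f c
    exact ⟨k, b ⊗ₜ r, by simp [TensorProduct.smul_tmul', ← h, mul_comm]⟩
  | add x y hx hy =>
    obtain ⟨k, z, h⟩ := hx
    obtain ⟨k', z', h'⟩ := hy
    refine ⟨k + k', f ^ k' • z + f ^ k • z', ?_⟩
    rw [map_add, baseMap_smul, baseMap_smul, h, h', map_pow, map_pow,
      IsScalarTower.toAlgHom_apply, smul_smul, smul_smul, smul_add, pow_add,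
      mul_comm]

end Away

end BaseChange

section LocallyFree

theorem span_range_eq_top {B ι : Type*} [CommRing B] {f : ι → B}
    (h : ∀ p : PrimeSpectrum B, ∃ i, f i ∉ p.asIdeal) : Ideal.span (Set.range f) = ⊤ := by
  rw [← PrimeSpectrum.iSup_basicOpen_eq_top_iff, eq_top_iff]
  exact fun p _ => TopologicalSpace.Opens.mem_iSup.2 (h p)

theorem exists_away_equiv_away {B : Type*} [CommRing B] (f : B)
    (q : PrimeSpectrum (Localization.Away f)) (g : Localization.Away f) (hg : g ∉ q.asIdeal) :
    ∃ h : B, h ∉ (PrimeSpectrum.comap (algebraMap B (Localization.Away f)) q).asIdeal ∧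
      Nonempty (Localization.Away g ≃ₐ[B] Localization.Away h) := by
  obtain ⟨k, b, hb⟩ := IsLocalization.Away.surj f g
  have hf : IsUnit (algebraMap B (Localization.Away f) f) :=
    IsLocalization.Away.algebraMap_isUnit f
  have hgb : Associated g (algebraMap B (Localization.Away f) b) :=
    ⟨(hf.pow k).unit, hb⟩
  have := IsLocalization.Away.of_associated (S := Localization.Away g) hgb
  have := IsLocalization.Away.mul' (Localization.Away f) (Localization.Away g) f b
  refine ⟨f * b, fun hmem => ?_, ⟨IsLocalization.algEquiv (.powers (f * b)) _ _⟩⟩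
  rcases (PrimeSpectrum.comap _ q).isPrime.mem_or_mem hmem with h | h
  · exact q.isPrime.ne_top (Ideal.eq_top_of_isUnit_mem _ h hf)
  · exact hg ((Ideal.mem_iff_of_associated hgb).2 h)

variable {B : Type*} [CommRing B] {Q : Type*} [AddCommGroup Q] [Module B Q] {n : ℕ}

theorem IsLocallyFreeOfRank.of_equiv (e : Q ≃ₗ[B] (Fin n → B)) : IsLocallyFreeOfRank B Q n :=
  fun p => ⟨1, p.isPrime.one_notMem, ⟨e.baseChange B (Localization.Away (1 : B)) _ _ ≪≫ₗ
    TensorProduct.piScalarRight _ _ _ _⟩⟩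

theorem nonempty_equiv_of_algHom {D C : Type*} [CommRing D] [CommRing C] [Algebra B D]
    [Algebra B C] (χ : D →ₐ[B] C) (h : Nonempty (D ⊗[B] Q ≃ₗ[D] (Fin n → D))) :
    Nonempty (C ⊗[B] Q ≃ₗ[C] (Fin n → C)) := by
  let _ : Algebra D C := χ.toRingHom.toAlgebra
  have : IsScalarTower B D C := IsScalarTower.of_algebraMap_eq fun r => (χ.commutes r).symm
  obtain ⟨g⟩ := h
  exact ⟨(AlgebraTensorModule.cancelBaseChange B D C C Q).symm ≪≫ₗ
    g.baseChange D C _ _ ≪≫ₗ TensorProduct.piScalarRight _ _ _ _⟩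

theorem IsLocallyFreeOfRank.of_away
    (h : ∀ p : PrimeSpectrum B, ∃ f : B, f ∉ p.asIdeal ∧
      IsLocallyFreeOfRank (Localization.Away f) (Localization.Away f ⊗[B] Q) n) :
    IsLocallyFreeOfRank B Q n := by
  intro p
  obtain ⟨f, hf, h⟩ := h p
  obtain ⟨q, rfl⟩ : p ∈ Set.range (PrimeSpectrum.comap (algebraMap B (Localization.Away f))) := by
    rwa [PrimeSpectrum.localization_away_comap_range (Localization.Away f) f]
  obtain ⟨g, hg, ⟨e⟩⟩ := h q
  obtain ⟨d, hd, ⟨χ⟩⟩ := exists_away_equiv_away f q g hg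
  exact ⟨d, hd, nonempty_equiv_of_algHom χ.toAlgHom
    ⟨(AlgebraTensorModule.cancelBaseChange B _ _ _ Q).symm ≪≫ₗ e⟩⟩

theorem IsLocallyFreeOfRank.finite (h : IsLocallyFreeOfRank B Q n) : Module.Finite B Q := by
  choose f hf e using h
  refine Module.Finite.of_localizationSpan' _ (span_range_eq_top fun p => ⟨p, hf p⟩)
    (Mₚ := fun r => Localization.Away r.1 ⊗[B] Q)
    (Rₚ := fun r => Localization.Away r.1)
    (fun r => TensorProduct.mk B (Localization.Away r.1) Q 1) ?_
  rintro ⟨_, p, rfl⟩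
  exact Module.Finite.equiv (e p).some.symm

theorem IsLocallyFreeOfRank.bijective (h : IsLocallyFreeOfRank B Q n) {P : Type*}
    [AddCommGroup P] [Module B P] (b : P ≃ₗ[B] (Fin n → B)) (g : P →ₗ[B] Q)
    (hg : Function.Surjective g) : Function.Bijective g := by
  choose f hf e using h
  refine ⟨(injective_iff_map_eq_zero g).2 fun x hx => Module.eq_zero_of_isLocalized_span _
    (span_range_eq_top fun p => ⟨p, hf p⟩) _
    (fun r => TensorProduct.mk B (Localization.Away r.1) P 1) x ?_, hg⟩
  rintro ⟨_, p, rfl⟩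
  let b' : (Localization.Away (f p) ⊗[B] P) ≃ₗ[_] (Fin n → Localization.Away (f p)) :=
    b.baseChange B (Localization.Away (f p)) _ _ ≪≫ₗ TensorProduct.piScalarRight _ _ _ _
  have hs : Function.Surjective ((e p).some.toLinearMap ∘ₗ
      g.baseChange (Localization.Away (f p)) ∘ₗ b'.symm.toLinearMap) :=
    (e p).some.surjective.comp ((LinearMap.lTensor_surjective _ hg).comp b'.symm.surjective)
  apply b'.injective
  apply OrzechProperty.injective_of_surjective_endomorphism _ hs
  simp [hx]

end LocallyFree

section Coordinates

variable {A : Type*} [CommRing A] {E : Type*} [AddCommGroup E] [Module A E]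

theorem map_dual_baseChange {B C : Type*} [CommRing B] [Algebra A B] [CommRing C] [Algebra A C]
    (φ : B →ₐ[A] C) (ξ : Module.Dual A E) (y : B ⊗[A] E) :
    φ (ξ.baseChange B y) = ξ.baseChange C (φ.toLinearMap.rTensor E y) := by
  induction y with
  | zero => simp
  | add x y hx hy => simp only [map_add, hx, hy]
  | tmul b w => simp

theorem baseChange_repr_apply {ι : Type*} (b : Module.Basis ι A E) {B : Type*} [CommRing B]
    [Algebra A B] (y : B ⊗[A] E) (i : ι) :
    (b.baseChange B).repr y i = Module.Dual.baseChange B (b.coord i) y := by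
  induction y with
  | zero => simp
  | add x y hx hy => simp only [map_add, Finsupp.add_apply, hx, hy]
  | tmul c w => simp [Algebra.smul_def, mul_comm]

variable [Module.Free A E] {B : Type*} [CommRing B] [Algebra A B]

theorem ext_dual_baseChange {y z : B ⊗[A] E}
    (h : ∀ ξ : Module.Dual A E, ξ.baseChange B y = ξ.baseChange B z) : y = z :=
  ((Module.Free.chooseBasis A E).baseChange B).ext_elem fun i => by
    rw [baseChange_repr_apply, baseChange_repr_apply, h]

theorem zeroIdeal_le_ker_iff {C : Type*} [CommRing C] [Algebra A C] (φ : B →ₐ[A] C)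
    {N : Type*} [AddCommGroup N] [Module B N] (u : N →ₗ[B] B ⊗[A] E) :
    zeroIdeal u ≤ RingHom.ker φ ↔ ∀ x, φ.toLinearMap.rTensor E (u x) = 0 := by
  refine ⟨fun h => map_eq_zero_of_zeroIdeal_le φ u h, fun h => ?_⟩
  let b := Module.Free.chooseBasis A E
  have hφ (ζ : Module.Dual B (B ⊗[A] E)) (x : N) : φ (ζ (u x)) = 0 := by
    rw [← (b.baseChange B).linearCombination_repr (u x), Finsupp.linearCombination_apply,
      Finsupp.sum, map_sum, map_sum]
    refine Finset.sum_eq_zero fun i _ => ?_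
    rw [map_smul, smul_eq_mul, map_mul, baseChange_repr_apply, map_dual_baseChange, h, map_zero,
      zero_mul]
  rintro _ ⟨z, rfl⟩
  induction z with
  | zero => rw [map_zero]; exact zero_mem _
  | add x y hx hy => rw [map_add]; exact add_mem hx hy
  | tmul x ζ => exact hφ ζ x

end Coordinates

section EndBaseChange

open LinearMap (tensorProductEnd)

variable {A : Type*} [CommRing A] {F : Type*} [AddCommGroup F] [Module A F]

theorem tensorProductEnd_tmul_tmul {B : Type*} [CommRing B] [Algebra A B] (b c : B)
    (w : Module.End A F) (f : F) :
    tensorProductEnd A B F (b ⊗ₜ w) (c ⊗ₜ f) = (b * c) ⊗ₜ w f := by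
  rw [← smul_eq_mul, ← smul_tmul']
  rfl

theorem tensorProductEnd_bijective [Module.Free A F] [Module.Finite A F] (B : Type*) [CommRing B]
    [Algebra A B] : Function.Bijective (tensorProductEnd A B F) := by
  have h := (TensorProduct.isBaseChange A F B).end
  have hequiv : (tensorProductEnd A B F).toLinearMap = h.equiv.toLinearMap := by
    ext w f
    simp only [AlgHom.toLinearMap_apply, AlgebraTensorModule.curry_apply, curry_apply,
      LinearMap.restrictScalars_apply, LinearEquiv.coe_coe, IsBaseChange.equiv_tmul, one_smul]
    rw [tensorProductEnd_tmul_tmul, mul_one]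
    exact ((TensorProduct.isBaseChange A F B).endHom_comp_apply w f).symm
  exact (congrArg DFunLike.coe hequiv : ⇑(tensorProductEnd A B F) = h.equiv) ▸ h.equiv.bijective

theorem evalAt_baseChange {A : Type u} [CommRing A] {F : Type u} [AddCommGroup F] [Module A F]
    {B : Type*} [CommRing B] [Algebra A B] (e : F) (y : B ⊗[A] Module.End A F) :
    (evalAt e).baseChange B y = tensorProductEnd A B F y (1 ⊗ₜ e) := by
  induction y with
  | zero => simp
  | add x y hx hy => simp only [map_add, hx, hy, LinearMap.add_apply]
  | tmul b w => rw [tensorProductEnd_tmul_tmul, mul_one]; rfl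

end EndBaseChange

/-! ### The universal property of `H_R^β` -/

section Family

open LinearMap (tensorProductEnd)

variable {A : Type u} [CommRing A] {R F : Type u} [CommRing R] [Algebra A R] [AddCommGroup F]
  [Module A F] {B C : Type u} [CommRing B] [Algebra A B] [CommRing C] [Algebra A C]

/-- The linear map `B ⊗ R → B ⊗ F`, `r ↦ μ(r)(e)`, attached to a homomorphism
`μ : R → B ⊗ End_A(F)`. -/
def family (e : F) (μ : R →ₐ[A] B ⊗[A] Module.End A F) : B ⊗[A] R →ₗ[B] B ⊗[A] F :=
  (evalAt e).baseChange B ∘ₗ (algLift μ).toLinearMap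

theorem family_apply (e : F) (μ : R →ₐ[A] B ⊗[A] Module.End A F) (z : B ⊗[A] R) :
    family e μ z = tensorProductEnd A B F (algLift μ z) (1 ⊗ₜ e) :=
  evalAt_baseChange _ _

theorem family_tmul (e : F) (μ : R →ₐ[A] B ⊗[A] Module.End A F) (b : B) (r : R) :
    family e μ (b ⊗ₜ r) = b • (evalAt e).baseChange B (μ r) := by
  rw [family, LinearMap.comp_apply, AlgHom.toLinearMap_apply, algLift_tmul, map_smul]

theorem family_mul (e : F) (μ : R →ₐ[A] B ⊗[A] Module.End A F) (y z : B ⊗[A] R) :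
    family e μ (y * z) = tensorProductEnd A B F (algLift μ y) (family e μ z) := by
  rw [family_apply, family_apply, map_mul, map_mul, Module.End.mul_apply]

/-- The homomorphism `μ : R → B ⊗ End_A(F)` is compatible with the section `β`: it satisfies
`μ(β(f))(e) = f` for all `f`. -/
def IsCompatible (e : F) (β : F →ₗ[A] R) (μ : R →ₐ[A] B ⊗[A] Module.End A F) : Prop :=
  ∀ f, (evalAt e).baseChange B (μ (β f)) = 1 ⊗ₜ f

namespace IsCompatible

variable {e : F} {β : F →ₗ[A] R} {μ ν : R →ₐ[A] B ⊗[A] Module.End A F}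

theorem family_section (h : IsCompatible e β μ) (x : B ⊗[A] F) :
    family e μ (β.baseChange B x) = x := by
  induction x with
  | zero => simp
  | add x y hx hy => simp only [map_add, hx, hy]
  | tmul b f => rw [LinearMap.baseChange_tmul, family_tmul, h f, smul_tmul', smul_eq_mul, mul_one]

theorem isSectionHom (h : IsCompatible e β μ) : IsSectionHom e β (family e μ) where
  surjective y := ⟨β.baseChange B y, h.family_section y⟩
  ker_isIdeal :=
    ⟨{ LinearMap.ker (family e μ) with
        smul_mem' := fun y z (hz : family e μ z = 0) => by
          change family e μ (y * z) = 0
          rw [family_mul, hz, map_zero] }, rfl⟩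
  map_one := by
    rw [family_apply, ← Algebra.TensorProduct.one_def, map_one, map_one, Module.End.one_apply]
  comp_section := LinearMap.ext h.family_section

theorem tensorProductEnd_apply (h : IsCompatible e β μ) (z : B ⊗[A] R) (x : B ⊗[A] F) :
    tensorProductEnd A B F (algLift μ z) x = family e μ (z * β.baseChange B x) := by
  rw [family_mul, h.family_section]

theorem family_eq_of_ker_eq (hμ : IsCompatible e β μ) (hν : IsCompatible e β ν)
    (h : LinearMap.ker (family e μ) = LinearMap.ker (family e ν)) : family e μ = family e ν := by
  refine LinearMap.ext fun z => ?_
  have hz : z - β.baseChange B (family e μ z) ∈ LinearMap.ker (family e μ) := by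
    rw [LinearMap.mem_ker, map_sub, hμ.family_section, sub_self]
  rw [h, LinearMap.mem_ker, map_sub, hν.family_section, sub_eq_zero] at hz
  exact hz.symm

theorem eq_of_ker_eq [Module.Free A F] [Module.Finite A F] (hμ : IsCompatible e β μ)
    (hν : IsCompatible e β ν) (h : LinearMap.ker (family e μ) = LinearMap.ker (family e ν)) :
    μ = ν := by
  refine AlgHom.ext fun r => ?_
  have hr : algLift μ (1 ⊗ₜ r) = algLift ν (1 ⊗ₜ r) :=
    (tensorProductEnd_bijective B).1 <| LinearMap.ext fun x => by
      rw [hμ.tensorProductEnd_apply, hν.tensorProductEnd_apply, hμ.family_eq_of_ker_eq hν h]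
  simpa only [algLift_tmul, one_smul] using hr

end IsCompatible

/-- The base change along `φ : B → C` of a homomorphism `R → B ⊗ E` of `A`-algebras. -/
abbrev changeBase {E : Type*} [Ring E] [Algebra A E] (φ : B →ₐ[A] C) (μ : R →ₐ[A] B ⊗[A] E) :
    R →ₐ[A] C ⊗[A] E :=
  (Algebra.TensorProduct.map φ (AlgHom.id A E)).comp μ

theorem evalAt_baseChange_map (φ : B →ₐ[A] C) (e : F) (y : B ⊗[A] Module.End A F) :
    (evalAt e).baseChange C (Algebra.TensorProduct.map φ (AlgHom.id A _) y) =
      φ.toLinearMap.rTensor F ((evalAt e).baseChange B y) := by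
  induction y with
  | zero => simp
  | add x y hx hy => simp only [map_add, hx, hy]
  | tmul b w => simp

theorem IsCompatible.changeBase {e : F} {β : F →ₗ[A] R} {μ : R →ₐ[A] B ⊗[A] Module.End A F}
    (h : IsCompatible e β μ) (φ : B →ₐ[A] C) : IsCompatible e β (changeBase φ μ) := fun f => by
  rw [AlgHom.comp_apply, evalAt_baseChange_map, h f, LinearMap.rTensor_tmul,
    AlgHom.toLinearMap_apply, map_one]

theorem cancelBaseChange_tmul_eq_smul [Algebra B C] [IsScalarTower A B C] (c : C)
    (y : B ⊗[A] F) : AlgebraTensorModule.cancelBaseChange A B C C F (c ⊗ₜ y) =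
      c • (IsScalarTower.toAlgHom A B C).toLinearMap.rTensor F y := by
  induction y with
  | zero => simp
  | add x y hx hy => simp only [map_add, tmul_add, smul_add, hx, hy]
  | tmul b f =>
    rw [AlgebraTensorModule.cancelBaseChange_tmul, LinearMap.rTensor_tmul, smul_tmul',
      Algebra.smul_def, mul_comm]
    rfl

theorem family_changeBase (e : F) [Algebra B C] [IsScalarTower A B C]
    (μ : R →ₐ[A] B ⊗[A] Module.End A F) :
    family e (changeBase (IsScalarTower.toAlgHom A B C) μ) =
      (AlgebraTensorModule.cancelBaseChange A B C C F).toLinearMap ∘ₗ quotMap C (family e μ) :=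
  AlgebraTensorModule.ext fun c r => by
    rw [LinearMap.comp_apply, quotMap_tmul, family_tmul, family_tmul, one_smul,
      LinearEquiv.coe_coe, cancelBaseChange_tmul_eq_smul, AlgHom.comp_apply, evalAt_baseChange_map]

theorem ker_family_changeBase {e : F} (φ : B →ₐ[A] C) (μ : R →ₐ[A] B ⊗[A] Module.End A F)
    (hs : Function.Surjective (family e μ)) (I : Ideal (B ⊗[A] R))
    (hI : I.restrictScalars B = LinearMap.ker (family e μ)) :
    (I.map (baseMap R φ)).restrictScalars C = LinearMap.ker (family e (changeBase φ μ)) := by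
  let _ : Algebra B C := φ.toRingHom.toAlgebra
  have : IsScalarTower A B C := IsScalarTower.of_algebraMap_eq fun r => (φ.commutes r).symm
  exact (ker_quotMap (family e μ) hs I hI).trans <|
    (LinearEquiv.ker_comp _ _).symm.trans (congrArg LinearMap.ker (family_changeBase e μ).symm)

end Family

section UniversalProperty

theorem zeroIdeal_toSpanSingleton_le_ker_iff {A B C E : Type*} [CommRing A] [CommRing B]
    [Algebra A B] [CommRing C] [Algebra A C] [AddCommGroup E] [Module A E] [Module.Free A E]
    (φ : B →ₐ[A] C) (y : B ⊗[A] E) :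
    zeroIdeal (LinearMap.toSpanSingleton B (B ⊗[A] E) y) ≤ RingHom.ker φ ↔
      φ.toLinearMap.rTensor E y = 0 := by
  refine (zeroIdeal_le_ker_iff φ _).trans ⟨fun h => by simpa using h 1, fun h b => ?_⟩
  rw [LinearMap.toSpanSingleton_apply, rTensor_smul, h, smul_zero]

theorem zeroIdeal_le_ker_iff_one_tmul {A B C E N : Type*} [CommRing A] [CommRing B] [Algebra A B]
    [CommRing C] [Algebra A C] [AddCommGroup E] [Module A E] [Module.Free A E] [AddCommGroup N]
    [Module A N] (φ : B →ₐ[A] C) (u : B ⊗[A] N →ₗ[B] B ⊗[A] E) :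
    zeroIdeal u ≤ RingHom.ker φ ↔ ∀ x, φ.toLinearMap.rTensor E (u (1 ⊗ₜ x)) = 0 := by
  refine (zeroIdeal_le_ker_iff φ u).trans ⟨fun h x => h _, fun h y => ?_⟩
  induction y with
  | zero => simp
  | add x y hx hy => rw [map_add, map_add, hx, hy, add_zero]
  | tmul b x =>
    have hb : b ⊗ₜ[A] x = b • ((1 : B) ⊗ₜ[A] x) := by rw [smul_tmul', smul_eq_mul, mul_one]
    rw [hb, map_smul, rTensor_smul, h, smul_zero]

theorem map_id_map_id {A B C D E : Type*} [CommRing A] [CommRing B] [Algebra A B] [CommRing C]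
    [Algebra A C] [CommRing D] [Algebra A D] [Ring E] [Algebra A E] (φ : B →ₐ[A] C)
    (ψ : C →ₐ[A] D) (y : B ⊗[A] E) :
    Algebra.TensorProduct.map ψ (AlgHom.id A E) (Algebra.TensorProduct.map φ (AlgHom.id A E) y) =
      Algebra.TensorProduct.map (ψ.comp φ) (AlgHom.id A E) y :=
  DFunLike.congr_fun (Algebra.TensorProduct.map_comp ψ φ (AlgHom.id A E) (AlgHom.id A E)).symm y

theorem symmetricAlgebra_hom_ext {A M E : Type*} [CommRing A] [AddCommGroup M] [Module A M]
    [Ring E] [Algebra A E] {f g : SymmetricAlgebra A M →ₐ[A] E}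
    (h : ∀ x, f (SymmetricAlgebra.ι A M x) = g (SymmetricAlgebra.ι A M x)) : f = g := by
  refine AlgHom.ext fun s => ?_
  induction s using SymmetricAlgebra.induction with
  | algebraMap r => rw [f.commutes, g.commutes]
  | ι x => exact h x
  | mul a b ha hb => rw [map_mul, map_mul, ha, hb]
  | add a b ha hb => rw [map_add, map_add, ha, hb]

theorem dual_baseChange_rTensor_assoc_symm {A : Type*} [CommRing A] {M E S : Type*}
    [AddCommGroup M] [Module A M] [AddCommGroup E] [Module A E] [CommRing S] [Algebra A S]
    (ι : M ⊗[A] Module.Dual A E →ₗ[A] S) (ξ : Module.Dual A E) (x : M)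
    (τ : Module.Dual A E ⊗[A] E) :
    ξ.baseChange S (ι.rTensor E ((TensorProduct.assoc A M (Module.Dual A E) E).symm (x ⊗ₜ τ))) =
      ι (x ⊗ₜ (ξ ∘ₗ dualTensorHom A E E τ)) := by
  induction τ with
  | zero => simp
  | add a b ha hb => simp only [tmul_add, map_add, ha, hb, LinearMap.comp_add]
  | tmul η w =>
    have h : ξ ∘ₗ dualTensorHom A E E (η ⊗ₜ[A] w) = ξ w • η := LinearMap.ext fun v => by
      simp [mul_comm]
    rw [TensorProduct.assoc_symm_tmul, LinearMap.rTensor_tmul, h, tmul_smul, map_smul]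
    simp [Algebra.smul_def]

variable {A : Type u} [CommRing A] {F : Type u} [AddCommGroup F] [Module A F]
  [Module.Free A F] [Module.Finite A F] {M : Type u} [AddCommGroup M] [Module A M]

theorem mu_one_tmul (x : M) : mu A F M (1 ⊗ₜ x) = muAux A F M x := by
  rw [mu, LinearMap.liftBaseChange_tmul, one_smul]

theorem dual_baseChange_muAux (ξ : Module.Dual A (Module.End A F)) (x : M) :
    ξ.baseChange (SymEnd A F M) (muAux A F M x) = SymmetricAlgebra.ι A _ (x ⊗ₜ ξ) := by
  have hid : dualTensorHom A _ _ (coevEnd A F) = LinearMap.id :=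
    (dualTensorHomEquiv A (Module.End A F) (Module.End A F)).apply_symm_apply _
  have h := dual_baseChange_rTensor_assoc_symm
    (SymmetricAlgebra.ι A (M ⊗[A] Module.Dual A (Module.End A F))) ξ x (coevEnd A F)
  rwa [hid, LinearMap.comp_id] at h

variable {B : Type u} [CommRing B] [Algebra A B]

theorem exists_symEnd_hom (g : M →ₗ[A] B ⊗[A] Module.End A F) :
    ∃ ψ : SymEnd A F M →ₐ[A] B, ∀ x,
      Algebra.TensorProduct.map ψ (AlgHom.id A _) (muAux A F M x) = g x := by
  let l : M →ₗ[A] Module.Dual A (Module.End A F) →ₗ[A] B := LinearMap.mk₂ A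
    (fun x ξ => Module.Dual.baseChange B ξ (g x))
    (fun x y ξ => by rw [map_add, map_add])
    (fun a x ξ => by rw [map_smul, ← algebraMap_smul B, map_smul, algebraMap_smul])
    (fun x ξ η => by rw [map_add, LinearMap.add_apply])
    (fun a x ξ => by rw [map_smul, LinearMap.smul_apply])
  refine ⟨SymmetricAlgebra.lift (TensorProduct.lift l), fun x => ext_dual_baseChange fun ξ => ?_⟩
  have h := map_dual_baseChange (SymmetricAlgebra.lift (TensorProduct.lift l)) ξ (muAux A F M x)
  rw [dual_baseChange_muAux, SymmetricAlgebra.lift_ι_apply] at h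
  exact h.symm

theorem symEnd_hom_ext {ψ ψ' : SymEnd A F M →ₐ[A] B}
    (h : ∀ x, Algebra.TensorProduct.map ψ (AlgHom.id A _) (muAux A F M x) =
      Algebra.TensorProduct.map ψ' (AlgHom.id A _) (muAux A F M x)) : ψ = ψ' := by
  refine SymmetricAlgebra.algHom_ext (TensorProduct.ext' fun x ξ => ?_)
  change ψ (SymmetricAlgebra.ι A _ (x ⊗ₜ ξ)) = ψ' (SymmetricAlgebra.ι A _ (x ⊗ₜ ξ))
  rw [← dual_baseChange_muAux, map_dual_baseChange, map_dual_baseChange]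
  exact congrArg _ (h x)

theorem muH_ι (x : M) : muH A F M (1 ⊗ₜ SymmetricAlgebra.ι A M x) =
    Algebra.TensorProduct.map (rhoH A F M) (AlgHom.id A _) (muAux A F M x) := by
  rw [muH, algLift_tmul, one_smul]
  refine (symLift_ι _ _ x).trans ?_
  change homMap (rhoH A F M) (mu A F M) (1 ⊗ₜ x) = _
  rw [homMap, LinearMap.liftBaseChange_tmul, one_smul, ← mu_one_tmul]
  rfl

theorem idealH_le_ker (ψ : SymEnd A F M →ₐ[A] B) (g : SymmetricAlgebra A M →ₐ[A]
      B ⊗[A] Module.End A F)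
    (h : ∀ x, Algebra.TensorProduct.map ψ (AlgHom.id A _) (muAux A F M x) =
      g (SymmetricAlgebra.ι A M x)) : idealH A F M ≤ RingHom.ker ψ := by
  refine iSup₂_le fun x y => (zeroIdeal_toSpanSingleton_le_ker_iff ψ _).2 ?_
  change Algebra.TensorProduct.map ψ (AlgHom.id A _) (muCommutator A F M x y) = 0
  rw [muCommutator, mu_one_tmul, mu_one_tmul, map_sub, map_mul, map_mul, h, h, ← map_mul g,
    ← map_mul g, mul_comm, sub_self]

theorem exists_algH_hom (g : SymmetricAlgebra A M →ₐ[A] B ⊗[A] Module.End A F) :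
    ∃ ψ : AlgH A F M →ₐ[A] B, ∀ s,
      Algebra.TensorProduct.map ψ (AlgHom.id A _) (muH A F M (1 ⊗ₜ s)) = g s := by
  obtain ⟨ψ₀, h₀⟩ := exists_symEnd_hom (g.toLinearMap ∘ₗ SymmetricAlgebra.ι A M)
  let ψ : AlgH A F M →ₐ[A] B := Ideal.Quotient.liftₐ (idealH A F M) ψ₀ (idealH_le_ker ψ₀ g h₀)
  have hψ : ψ.comp (rhoH A F M) = ψ₀ := Ideal.Quotient.liftₐ_comp _ _ _
  have hg : changeBase ψ (((muH A F M).restrictScalars A).comp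
      Algebra.TensorProduct.includeRight) = g := symmetricAlgebra_hom_ext fun x => by
    change Algebra.TensorProduct.map ψ (AlgHom.id A _)
      (muH A F M (1 ⊗ₜ SymmetricAlgebra.ι A M x)) = _
    rw [muH_ι, map_id_map_id, hψ, h₀]
    rfl
  exact ⟨ψ, DFunLike.congr_fun hg⟩

variable {R : Type u} [CommRing R] [Algebra A R] (π : SymmetricAlgebra A M →ₐ[A] R)

theorem muHR_tmul (hπ : Function.Surjective π) (s : SymmetricAlgebra A M) :
    muHR F π hπ (1 ⊗ₜ π s) =
      Algebra.TensorProduct.map (rhoHR F π) (AlgHom.id A _) (muH A F M (1 ⊗ₜ s)) := by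
  rw [muHR, algLift_tmul, one_smul]
  refine (descend_apply π hπ _ _ s).trans ?_
  change homAlgMap (rhoHR F π) (muH A F M) (1 ⊗ₜ s) = _
  rw [homAlgMap, algLift_tmul, one_smul]
  rfl

theorem exists_algHR_hom (hπ : Function.Surjective π) (μ : R →ₐ[A] B ⊗[A] Module.End A F) :
    ∃ ψ : AlgHR F π →ₐ[A] B, ∀ r,
      Algebra.TensorProduct.map ψ (AlgHom.id A _) (muHR F π hπ (1 ⊗ₜ r)) = μ r := by
  obtain ⟨ψ₀, h₀⟩ := exists_algH_hom (μ.comp π)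
  have hle : zeroIdeal (vMap F π) ≤ RingHom.ker ψ₀ :=
    (zeroIdeal_le_ker_iff_one_tmul ψ₀ _).2 fun s => by
      change Algebra.TensorProduct.map ψ₀ (AlgHom.id A _) (muH A F M (1 ⊗ₜ s.1)) = 0
      rw [h₀, AlgHom.comp_apply, RingHom.mem_ker.1 s.2, map_zero]
  let ψ : AlgHR F π →ₐ[A] B := Ideal.Quotient.liftₐ (zeroIdeal (vMap F π)) ψ₀ hle
  have hψ : ψ.comp (rhoHR F π) = ψ₀ := Ideal.Quotient.liftₐ_comp _ _ _
  refine ⟨ψ, fun r => ?_⟩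
  obtain ⟨s, rfl⟩ := hπ r
  rw [muHR_tmul, map_id_map_id, hψ, h₀, AlgHom.comp_apply]

variable (hπ : Function.Surjective π) (e : F) (β : F →ₗ[A] R)

/-- The universal homomorphism `R → H_R^β ⊗ End_A(F)`; the universal family is
`family e (univHom π hπ e β)`. -/
def univHom : R →ₐ[A] AlgHRSection π hπ e β ⊗[A] Module.End A F :=
  changeBase (rhoHRSection π hπ e β)
    (((muHR F π hπ).restrictScalars A).comp Algebra.TensorProduct.includeRight)

theorem univHom_apply (r : R) : univHom π hπ e β r =
    Algebra.TensorProduct.map (rhoHRSection π hπ e β) (AlgHom.id A _) (muHR F π hπ (1 ⊗ₜ r)) := rfl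

theorem zeroIdeal_id_sub_uMap_le_ker_iff (φ : AlgHR F π →ₐ[A] B) :
    zeroIdeal (LinearMap.id - uMap π hπ e β) ≤ RingHom.ker φ ↔
      ∀ f, (evalAt e).baseChange B
        (Algebra.TensorProduct.map φ (AlgHom.id A _) (muHR F π hπ (1 ⊗ₜ β f))) = 1 ⊗ₜ f := by
  rw [zeroIdeal_le_ker_iff_one_tmul]
  refine forall_congr' fun f => ?_
  rw [LinearMap.sub_apply, map_sub, sub_eq_zero, evalAt_baseChange_map, LinearMap.id_apply,
    LinearMap.rTensor_tmul, AlgHom.toLinearMap_apply, map_one, eq_comm]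
  rfl

theorem isCompatible_univHom : IsCompatible e β (univHom π hπ e β) :=
  (zeroIdeal_id_sub_uMap_le_ker_iff π hπ e β _).1 (Ideal.Quotient.mkₐ_ker A _).ge

theorem exists_algHRSection_hom {μ : R →ₐ[A] B ⊗[A] Module.End A F} (hμ : IsCompatible e β μ) :
    ∃ ψ : AlgHRSection π hπ e β →ₐ[A] B, changeBase ψ (univHom π hπ e β) = μ := by
  obtain ⟨ψ₀, h₀⟩ := exists_algHR_hom π hπ μ
  have hle : zeroIdeal (LinearMap.id - uMap π hπ e β) ≤ RingHom.ker ψ₀ :=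
    (zeroIdeal_id_sub_uMap_le_ker_iff π hπ e β ψ₀).2 fun f => by rw [h₀, hμ f]
  let ψ : AlgHRSection π hπ e β →ₐ[A] B :=
    Ideal.Quotient.liftₐ (zeroIdeal (LinearMap.id - uMap π hπ e β)) ψ₀ hle
  have hψ : ψ.comp (rhoHRSection π hπ e β) = ψ₀ := Ideal.Quotient.liftₐ_comp _ _ _
  refine ⟨ψ, AlgHom.ext fun r => ?_⟩
  rw [AlgHom.comp_apply, univHom_apply, map_id_map_id, hψ, h₀]

theorem algHRSection_hom_ext {ψ ψ' : AlgHRSection π hπ e β →ₐ[A] B}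
    (h : changeBase ψ (univHom π hπ e β) = changeBase ψ' (univHom π hπ e β)) : ψ = ψ' := by
  let ρ : SymEnd A F M →ₐ[A] AlgHRSection π hπ e β :=
    ((rhoHRSection π hπ e β).comp (rhoHR F π)).comp (rhoH A F M)
  have hH : Function.Surjective (rhoH A F M) := Ideal.Quotient.mk_surjective
  have hHR : Function.Surjective (rhoHR F π) := Ideal.Quotient.mk_surjective
  have hHRβ : Function.Surjective (rhoHRSection π hπ e β) := Ideal.Quotient.mk_surjective
  have hρ : Function.Surjective ρ := (hHRβ.comp hHR).comp hH
  have hx (x : M) : univHom π hπ e β (π (SymmetricAlgebra.ι A M x)) =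
      Algebra.TensorProduct.map ρ (AlgHom.id A _) (muAux A F M x) := by
    rw [univHom_apply, muHR_tmul, muH_ι, map_id_map_id, map_id_map_id]
  rw [← AlgHom.cancel_right hρ]
  refine symEnd_hom_ext fun x => ?_
  rw [← map_id_map_id ρ ψ, ← map_id_map_id ρ ψ', ← hx]
  exact DFunLike.congr_fun h (π (SymmetricAlgebra.ι A M x))

end UniversalProperty

section Points

open LinearMap (tensorProductEnd)

variable {A : Type u} [CommRing A] {R F : Type u} [CommRing R] [Algebra A R] [AddCommGroup F]
  [Module A F] {B C : Type u} [CommRing B] [Algebra A B] [CommRing C] [Algebra A C] {n : ℕ}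

theorem exists_hilbPoint (b : Module.Basis (Fin n) A F) {e : F} {β : F →ₗ[A] R}
    {u : B ⊗[A] R →ₗ[B] B ⊗[A] F} (h : IsSectionHom e β u) :
    ∃ x : HilbPoint (A := A) R n B, x.IsClassOf u ∧
      Function.Surjective (sectionMap β B x.ideal) := by
  obtain ⟨I, hI⟩ := h.ker_isIdeal
  obtain ⟨σ, -⟩ := exists_linearEquiv_of_ker_eq (surjective_mk I) h.surjective
    ((ker_mk I).symm.trans hI)
  refine ⟨⟨I, .of_equiv (σ ≪≫ₗ (b.baseChange B).equivFun)⟩, hI, ?_⟩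
  rw [sectionMap_surjective_iff β I u h.surjective hI, h.comp_section]
  exact Function.surjective_id

theorem exists_algHom_tensorProductEnd_apply [Module.Free A F] [Module.Finite A F]
    {Q : Type*} [CommRing Q] [Algebra A Q] [Algebra B Q] [IsScalarTower A B Q]
    (ρ : R →ₐ[A] Q) (σ : B ⊗[A] F ≃ₗ[B] Q) :
    ∃ μ : R →ₐ[A] B ⊗[A] Module.End A F, ∀ r y,
      tensorProductEnd A B F (μ r) y = σ.symm (ρ r * σ y) := by
  let θ : B ⊗[A] Module.End A F ≃ₐ[B] Module.End B (B ⊗[A] F) :=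
    AlgEquiv.ofBijective (tensorProductEnd A B F) (tensorProductEnd_bijective B)
  let κ : Q →ₐ[B] Module.End B (B ⊗[A] F) :=
    (σ.symm.conjAlgEquiv B).toAlgHom.comp (Algebra.lmul B Q)
  exact ⟨((θ.symm.toAlgHom.comp κ).restrictScalars A).comp ρ, fun r y =>
    LinearMap.congr_fun (θ.apply_symm_apply (κ (ρ r))) y⟩

theorem exists_isCompatible [Module.Free A F] [Module.Finite A F] (b : Module.Basis (Fin n) A F)
    {e : F} {β : F →ₗ[A] R} (hβ : β e = 1)
    (x : HilbPoint (A := A) R n B) (hx : Function.Surjective (sectionMap β B x.ideal)) :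
    ∃ μ : R →ₐ[A] B ⊗[A] Module.End A F, IsCompatible e β μ ∧ x.IsClassOf (family e μ) := by
  let q : B ⊗[A] R →ₐ[B] (B ⊗[A] R) ⧸ x.ideal := Ideal.Quotient.mkₐ B x.ideal
  let σ : B ⊗[A] F ≃ₗ[B] (B ⊗[A] R) ⧸ x.ideal := LinearEquiv.ofBijective (sectionMap β B x.ideal)
    (x.isLocallyFree.bijective (b.baseChange B).equivFun _ hx)
  have hσ (f : F) : σ (1 ⊗ₜ f) = q (1 ⊗ₜ β f) := rfl
  have hone : σ (1 ⊗ₜ e) = 1 := by rw [hσ, hβ, ← Algebra.TensorProduct.one_def, map_one]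
  obtain ⟨μ, hμ⟩ := exists_algHom_tensorProductEnd_apply
    ((q.restrictScalars A).comp Algebra.TensorProduct.includeRight) σ
  have heval (r : R) : (evalAt e).baseChange B (μ r) = σ.symm (q (1 ⊗ₜ r)) := by
    rw [evalAt_baseChange, hμ, hone, mul_one]
    rfl
  have hfamily : family e μ = σ.symm.toLinearMap ∘ₗ q.toLinearMap :=
    AlgebraTensorModule.ext fun c r => by
      rw [family_tmul, heval, ← map_smul, ← map_smul, smul_tmul', smul_eq_mul, mul_one]
      rfl
  refine ⟨μ, fun f => by rw [heval, ← hσ, σ.symm_apply_apply], ?_⟩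
  rw [HilbPoint.IsClassOf, hfamily, LinearEquiv.ker_comp, ← ker_mk]

theorem HilbPoint.IsClassOf.unique {x y : HilbPoint (A := A) R n B}
    {u : B ⊗[A] R →ₗ[B] B ⊗[A] F} (hx : x.IsClassOf u) (hy : y.IsClassOf u) : x = y :=
  HilbPoint.ext (Submodule.restrictScalars_injective B _ _ (hx.trans hy.symm))

theorem HilbPoint.IsClassOf.map {x : HilbPoint (A := A) R n B} {e : F}
    {μ : R →ₐ[A] B ⊗[A] Module.End A F} (hx : x.IsClassOf (family e μ))
    (hs : Function.Surjective (family e μ)) (φ : B →ₐ[A] C) :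
    (x.map φ).IsClassOf (family e (changeBase φ μ)) :=
  ker_family_changeBase φ μ hs x.ideal hx

variable [Module.Free A F] [Module.Finite A F] {M : Type u} [AddCommGroup M] [Module A M]
  (π : SymmetricAlgebra A M →ₐ[A] R) (hπ : Function.Surjective π) {e : F} {β : F →ₗ[A] R}

theorem existsUnique_map_eq_of_isClassOf (b : Module.Basis (Fin n) A F) (hβ : β e = 1)
    {x : HilbPoint (A := A) R n (AlgHRSection π hπ e β)}
    (hx : x.IsClassOf (family e (univHom π hπ e β))) (y : HilbPoint (A := A) R n B)
    (hy : Function.Surjective (sectionMap β B y.ideal)) :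
    ∃! ψ : AlgHRSection π hπ e β →ₐ[A] B, x.map ψ = y := by
  have hu := isCompatible_univHom π hπ e β
  have hmap (ψ : AlgHRSection π hπ e β →ₐ[A] B) := hx.map hu.isSectionHom.surjective ψ
  obtain ⟨μ, hμ, hyμ⟩ := exists_isCompatible b hβ y hy
  obtain ⟨ψ, rfl⟩ := exists_algHRSection_hom π hπ e β hμ
  refine ⟨ψ, (hmap ψ).unique hyμ, ?_⟩
  rintro ψ' rfl
  exact algHRSection_hom_ext π hπ e β
    ((hu.changeBase ψ').eq_of_ker_eq hμ ((hmap ψ').symm.trans hyμ))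

theorem exists_iso_hilbSection (b : Module.Basis (Fin n) A F) (hβ : β e = 1) :
    ∃ Φ : coyoneda.obj (Opposite.op (CommAlgCat.of A (AlgHRSection π hπ e β))) ≅
        (hilbSection n β).toFunctor,
      HilbPoint.IsClassOf
        (Φ.hom.app (CommAlgCat.of A (AlgHRSection π hπ e β)) (𝟙 _)).1
        (universalFamily π hπ e β) := by
  obtain ⟨x, hx, hxs⟩ := exists_hilbPoint b (isCompatible_univHom π hπ e β).isSectionHom
  let K := CommAlgCat.of A (AlgHRSection π hπ e β)
  let x₀ : (hilbSection n β).toFunctor.obj K := ⟨x, hxs⟩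
  let Ψ : coyoneda.obj (Opposite.op K) ⟶ (hilbSection n β).toFunctor := coyonedaEquiv.symm x₀
  have hbij (B : CommAlgCat.{u} A) : Function.Bijective (Ψ.app B) := by
    have huniq (y : (hilbSection n β).toFunctor.obj B) :=
      existsUnique_map_eq_of_isClassOf π hπ b hβ hx y.1 y.2
    refine ⟨fun ψ ψ' h => CommAlgCat.hom_ext <| (huniq (Ψ.app B ψ)).unique rfl
      (congrArg Subtype.val h.symm), fun y => ?_⟩
    obtain ⟨ψ, hψ, -⟩ := huniq y
    exact ⟨CommAlgCat.ofHom ψ, Subtype.ext hψ⟩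
  have (B : CommAlgCat.{u} A) : IsIso (Ψ.app B) := (isIso_iff_bijective _).2 (hbij B)
  have : IsIso Ψ := NatIso.isIso_of_isIso_app Ψ
  have hone : (Ψ.app K (𝟙 K)).1 = x := HilbPoint.map_id R x
  exact ⟨asIso Ψ, (congrArg (·.IsClassOf (universalFamily π hπ e β)) hone).mpr hx⟩

end Points

/-! ### The open covering -/

section Support

variable {B : Type*} [CommRing B] {C : Type*} [CommRing C] [Algebra B C]

theorem baseChange_surjective_iff_subsingleton {P Q : Type*} [AddCommGroup P] [Module B P]
    [AddCommGroup Q] [Module B Q] (σ : P →ₗ[B] Q) :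
    Function.Surjective (σ.baseChange C) ↔ Subsingleton (C ⊗[B] (Q ⧸ LinearMap.range σ)) := by
  have hmk := (LinearMap.range σ).mkQ_surjective
  have hexact := lTensor_exact C (LinearMap.exact_map_mkQ_range σ) hmk
  refine ⟨fun hσ => ⟨(LinearMap.lTensor_surjective C hmk).forall₂.2 fun x y => ?_⟩,
    fun _ x => (hexact x).1 (Subsingleton.elim _ _)⟩
  rw [(hexact x).2 (hσ x), (hexact y).2 (hσ y)]

theorem mem_support_baseChange_iff {N : Type*} [AddCommGroup N] [Module B N] [Module.Finite B N]
    (q : PrimeSpectrum C) :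
    q ∈ Module.support C (C ⊗[B] N) ↔
      PrimeSpectrum.comap (algebraMap B C) q ∈ Module.support B N := by
  let p := PrimeSpectrum.comap (algebraMap B C) q
  let k := p.asIdeal.ResidueField
  let K := q.asIdeal.ResidueField
  let _ : Algebra k K :=
    (Ideal.ResidueField.map p.asIdeal q.asIdeal (algebraMap B C) rfl).toAlgebra
  have : IsScalarTower B k K := IsScalarTower.of_algebraMap_eq fun b =>
    (Ideal.ResidueField.map_algebraMap p.asIdeal q.asIdeal (algebraMap B C) rfl b).symm
  have e : K ⊗[C] (C ⊗[B] N) ≃ₗ[K] K ⊗[k] (k ⊗[B] N) :=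
    AlgebraTensorModule.cancelBaseChange B C K K N ≪≫ₗ
      (AlgebraTensorModule.cancelBaseChange B k K K N).symm
  rw [Module.mem_support_iff_nontrivial_residueField_tensorProduct,
    Module.mem_support_iff_nontrivial_residueField_tensorProduct, e.nontrivial_congr,
    Module.FaithfullyFlat.nontrivial_tensorProduct_iff_right]

theorem subsingleton_baseChange_iff {N : Type*} [AddCommGroup N] [Module B N]
    [Module.Finite B N] :
    Subsingleton (C ⊗[B] N) ↔
      Set.range (PrimeSpectrum.comap (algebraMap B C)) ⊆ (Module.support B N)ᶜ := by
  rw [← Module.support_eq_empty_iff (R := C), Set.eq_empty_iff_forall_notMem,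
    Set.range_subset_iff]
  exact forall_congr' fun q => not_congr (mem_support_baseChange_iff q)

end Support

section Spanning

variable {K : Type*} [Field K] {Q : Type*} [AddCommGroup Q] [Module K Q] {n : ℕ}

theorem IsLocallyFreeOfRank.nonempty_equiv (h : IsLocallyFreeOfRank K Q n) :
    Nonempty (Q ≃ₗ[K] (Fin n → K)) := by
  obtain ⟨f, hf, e⟩ := h ⊥
  have hf' : IsUnit (Algebra.ofId K K f) := isUnit_iff_ne_zero.2 hf
  obtain ⟨g⟩ := nonempty_equiv_of_algHom
    (IsLocalization.Away.liftAlgHom f hf' : Localization.Away f →ₐ[K] K) e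
  exact ⟨(TensorProduct.lid K Q).symm ≪≫ₗ g⟩

theorem exists_span_range_comp_eq_top {R : Type*} {v : R → Q}
    (hv : Submodule.span K (Set.range v) = ⊤) (e : Q ≃ₗ[K] (Fin n → K)) {r₀ : R}
    (hr₀ : v r₀ ≠ 0) (i : Fin n) :
    ∃ r : Fin n → R, r i = r₀ ∧ Submodule.span K (Set.range (v ∘ r)) = ⊤ := by
  classical
  obtain ⟨s, -, hs, hspan, hlin⟩ := exists_linearIndepOn_extension (v := v)
    ((linearIndepOn_singleton_iff K).2 hr₀) (Set.subset_univ {r₀})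
  rw [Set.image_univ, ← Submodule.span_le, hv, Set.image_eq_range] at hspan
  let σ : s ≃ Fin n :=
    (Module.Basis.mk hlin hspan).indexEquiv ((Pi.basisFun K (Fin n)).map e.symm)
  let τ : s ≃ Fin n := σ.trans (Equiv.swap (σ ⟨r₀, hs rfl⟩) i)
  have hτ : τ.symm i = ⟨r₀, hs rfl⟩ := τ.symm_apply_eq.2 (by simp [τ])
  refine ⟨fun j => τ.symm j, congrArg Subtype.val hτ, top_le_iff.1 ?_⟩
  rwa [← Function.comp_def, ← Function.comp_assoc, EquivLike.range_comp]

end Spanning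

section Covering

variable {A : Type u} [CommRing A] {R F : Type u} [CommRing R] [Algebra A R] [AddCommGroup F]
  [Module A F] {n : ℕ}

theorem isOpenSubfunctor_hilbSection (β : F →ₗ[A] R) :
    IsOpenSubfunctor (hilbSection n β) := by
  intro B x
  let I : Ideal (B ⊗[A] R) := HilbPoint.ideal x
  let q : B ⊗[A] R →ₗ[B] (B ⊗[A] R) ⧸ I := (Ideal.Quotient.mkₐ B I).toLinearMap
  let N := ((B ⊗[A] R) ⧸ I) ⧸ LinearMap.range (sectionMap β B I)
  have : Module.Finite B ((B ⊗[A] R) ⧸ I) := (HilbPoint.isLocallyFree x).finite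
  have : Module.Finite B N := inferInstance
  refine ⟨⟨(Module.support B N)ᶜ, Module.isClosed_support.isOpen_compl⟩, fun C φ => ?_⟩
  let _ : Algebra B C := φ.hom.toRingHom.toAlgebra
  have : IsScalarTower A B C := IsScalarTower.of_algebraMap_eq fun r => (φ.hom.commutes r).symm
  have hsection : (hilb A R n).map φ x ∈ (hilbSection n β).obj C ↔
      Function.Surjective (quotMap C q ∘ₗ β.baseChange C) :=
    sectionMap_surjective_iff β (I.map (baseMap R φ.hom)) (quotMap C q)
      (quotMap_surjective q (surjective_mk I)) (ker_quotMap q (surjective_mk I) I (ker_mk I))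
  have hcomp : quotMap C q ∘ₗ β.baseChange C = (sectionMap β B I).baseChange C ∘ₗ
      (AlgebraTensorModule.cancelBaseChange A B C C F).symm.toLinearMap :=
    AlgebraTensorModule.ext fun c f => by simp [quotMap_tmul, sectionMap, q]
  rw [hsection, hcomp, LinearMap.coe_comp, LinearEquiv.coe_coe, EquivLike.surjective_comp,
    baseChange_surjective_iff_subsingleton, subsingleton_baseChange_iff]
  rfl

theorem span_range_mk_one_tmul {K : Type*} [CommRing K] [Algebra A K] (I : Ideal (K ⊗[A] R)) :
    Submodule.span K (Set.range fun r : R => Ideal.Quotient.mk I (1 ⊗ₜ r)) = ⊤ := by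
  have h := congrArg (Submodule.map (Ideal.Quotient.mkₐ K I).toLinearMap)
    ((Submodule.baseChange_eq_span K ⊤).symm.trans (Submodule.baseChange_top (R := A) (M := R) K))
  rw [Submodule.map_span, Submodule.map_top, Submodule.map_top,
    LinearMap.range_eq_top.2 (surjective_mk I), LinearMap.coe_range, ← Set.range_comp] at h
  exact h

theorem exists_surjective_sectionMap_of_field {K : Type u} [Field K] [Algebra A K]
    (b : Module.Basis (Fin n) A F) (i : Fin n) (x : HilbPoint (A := A) R n K) :
    ∃ β : F →ₗ[A] R, β (b i) = 1 ∧ Function.Surjective (sectionMap β K x.ideal) := by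
  obtain ⟨e⟩ := x.isLocallyFree.nonempty_equiv
  have : Nonempty (Fin n) := ⟨i⟩
  have : Nontrivial ((K ⊗[A] R) ⧸ x.ideal) := e.toEquiv.nontrivial
  obtain ⟨r, hr, hspan⟩ := exists_span_range_comp_eq_top (span_range_mk_one_tmul x.ideal) e
    (r₀ := 1) (one_ne_zero (α := (K ⊗[A] R) ⧸ x.ideal)) i
  refine ⟨b.constr A r, by rw [b.constr_basis, hr], ?_⟩
  rw [← LinearMap.range_eq_top, ← top_le_iff, ← hspan, Submodule.span_le]
  rintro _ ⟨j, rfl⟩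
  exact ⟨1 ⊗ₜ b j, by simp [sectionMap, b.constr_basis]⟩

theorem isOpenCovering_hilbSection (b : Module.Basis (Fin n) A F) (i : Fin n) :
    IsOpenCovering (fun β : {β : F →ₗ[A] R // β (b i) = 1} => hilbSection n β.1) := by
  refine ⟨fun β => isOpenSubfunctor_hilbSection β.1, fun B x p => ?_⟩
  let φ : B ⟶ CommAlgCat.of A p.asIdeal.ResidueField :=
    CommAlgCat.ofHom (IsScalarTower.toAlgHom A B p.asIdeal.ResidueField)
  obtain ⟨β, hβ, hsurj⟩ := exists_surjective_sectionMap_of_field b i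
    ((hilb A R n).map φ x : HilbPoint (A := A) R n p.asIdeal.ResidueField)
  obtain ⟨U, hU⟩ := isOpenSubfunctor_hilbSection (n := n) β B x
  have hp : p ∈ U := by
    refine (hU _ φ).1 hsurj ⟨⊥, PrimeSpectrum.ext (Ideal.ext fun y => ?_)⟩
    exact Ideal.algebraMap_residueField_eq_zero
  obtain ⟨_, ⟨f, rfl⟩, hpf, hfU⟩ :=
    PrimeSpectrum.isTopologicalBasis_basic_opens.exists_subset_of_mem_open hp U.isOpen
  refine ⟨f, hpf, ⟨β, hβ⟩, (hU _ (awayHom B f)).2 (subset_trans (subset_of_eq ?_) hfU)⟩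
  exact PrimeSpectrum.localization_away_comap_range (Localization.Away f) f

end Covering

/-! ### Gluing schemes along equivalence relations -/

section Glue

open AlgebraicGeometry CategoryTheory.Limits

/-- Two points `p : T ⟶ U i` and `q : T ⟶ U j` are identified by the overlap
`U i ⟵ V i j ⟶ U j`. -/
def OverlapRel {J : Type u} {U : J → Scheme.{u}} {V : J → J → Scheme.{u}}
    (f : ∀ i j, V i j ⟶ U i) (g : ∀ i j, V i j ⟶ U j) {T : Scheme.{u}} (i j : J)
    (p : T ⟶ U i) (q : T ⟶ U j) : Prop :=
  ∃ r : T ⟶ V i j, r ≫ f i j = p ∧ r ≫ g i j = q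

/-- Charts `U i` with overlaps `U i ⟵ V i j ⟶ U j` that identify the points of the charts by an
equivalence relation: a form of gluing data in which the cocycle condition is a condition on
functors of points. -/
structure GluingRelation (J : Type u) where
  U : J → Scheme.{u}
  V : J → J → Scheme.{u}
  f : ∀ i j, V i j ⟶ U i
  g : ∀ i j, V i j ⟶ U j
  isOpenImmersion_f : ∀ i j, IsOpenImmersion (f i j)
  refl : ∀ {T : Scheme.{u}} (i) (p : T ⟶ U i), OverlapRel f g i i p p
  symm : ∀ {T : Scheme.{u}} {i j} {p : T ⟶ U i} {q : T ⟶ U j},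
    OverlapRel f g i j p q → OverlapRel f g j i q p
  trans : ∀ {T : Scheme.{u}} {i j k} {p : T ⟶ U i} {q : T ⟶ U j} {r : T ⟶ U k},
    OverlapRel f g i j p q → OverlapRel f g j k q r → OverlapRel f g i k p r

namespace GluingRelation

attribute [instance] isOpenImmersion_f

variable {J : Type u} (D : GluingRelation J)

theorem overlapRel_f_g (i j : J) : OverlapRel D.f D.g i j (D.f i j) (D.g i j) :=
  ⟨𝟙 _, Category.id_comp _, Category.id_comp _⟩

theorem f_eq_g (i : J) : D.f i i = D.g i i := by
  obtain ⟨r, hrf, hrg⟩ := D.refl i (D.f i i)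
  obtain rfl : r = 𝟙 _ := by rw [← cancel_mono (D.f i i), hrf, Category.id_comp]
  rw [← hrg, Category.id_comp]

theorem isIso_f (i : J) : IsIso (D.f i i) := by
  obtain ⟨r, hr, -⟩ := D.refl i (𝟙 (D.U i))
  refine ⟨r, ?_, hr⟩
  rw [← cancel_mono (D.f i i), Category.assoc, hr, Category.comp_id, Category.id_comp]

/-- The isomorphism `V i j ⟶ V j i` that exchanges the two projections. -/
def transition (i j : J) : D.V i j ⟶ D.V j i :=
  (D.symm (D.overlapRel_f_g i j)).choose

theorem transition_comp_f (i j : J) : D.transition i j ≫ D.f j i = D.g i j :=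
  (D.symm (D.overlapRel_f_g i j)).choose_spec.1

theorem transition_comp_g (i j : J) : D.transition i j ≫ D.g j i = D.f i j :=
  (D.symm (D.overlapRel_f_g i j)).choose_spec.2

theorem overlapRel_pullback (i j k : J) :
    OverlapRel D.f D.g j k (pullback.fst (D.f i j) (D.f i k) ≫ D.g i j)
      (pullback.snd (D.f i j) (D.f i k) ≫ D.g i k) :=
  D.trans (D.symm ⟨pullback.fst (D.f i j) (D.f i k), rfl, rfl⟩)
    ⟨pullback.snd (D.f i j) (D.f i k), pullback.condition.symm, rfl⟩

/-- The morphism `V i j ×[U i] V i k ⟶ V j k ×[U j] V j i` of the triple overlaps, as in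
`CategoryTheory.GlueData.t'`. -/
def transition' (i j k : J) :
    pullback (D.f i j) (D.f i k) ⟶ pullback (D.f j k) (D.f j i) :=
  pullback.lift (D.overlapRel_pullback i j k).choose (pullback.fst _ _ ≫ D.transition i j) <| by
    rw [(D.overlapRel_pullback i j k).choose_spec.1, Category.assoc, transition_comp_f]

theorem transition'_comp_snd (i j k : J) :
    D.transition' i j k ≫ pullback.snd _ _ = pullback.fst _ _ ≫ D.transition i j :=
  pullback.lift_snd _ _ _

theorem transition'_comp_fst_comp_f (i j k : J) :
    D.transition' i j k ≫ pullback.fst _ _ ≫ D.f j k = pullback.fst _ _ ≫ D.g i j := by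
  rw [transition', pullback.lift_fst_assoc, (D.overlapRel_pullback i j k).choose_spec.1]

theorem transition'_comp_fst_comp_g (i j k : J) :
    D.transition' i j k ≫ pullback.fst _ _ ≫ D.g j k = pullback.snd _ _ ≫ D.g i k := by
  rw [transition', pullback.lift_fst_assoc, (D.overlapRel_pullback i j k).choose_spec.2]

theorem transition'_comp_snd_comp_g (i j k : J) :
    D.transition' i j k ≫ pullback.snd _ _ ≫ D.g j i = pullback.fst _ _ ≫ D.f i j := by
  rw [transition', pullback.lift_snd_assoc, Category.assoc, transition_comp_g]

theorem transition'_cocycle (i j k : J) :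
    D.transition' i j k ≫ D.transition' j k i ≫ D.transition' k i j = 𝟙 _ := by
  rw [← cancel_mono (pullback.fst (D.f i j) (D.f i k) ≫ D.f i j)]
  simp only [Category.assoc, Category.id_comp]
  rw [transition'_comp_fst_comp_f, transition'_comp_fst_comp_g, transition'_comp_snd_comp_g]

/-- The gluing data in the sense of `AlgebraicGeometry.Scheme.GlueData`. -/
def glueData : Scheme.GlueData.{u} where
  J := J
  U := D.U
  V ij := D.V ij.1 ij.2
  f := D.f
  f_id := D.isIso_f
  t := D.transition
  t_id i := by rw [← cancel_mono (D.f i i), transition_comp_f, Category.id_comp, f_eq_g]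
  t' := D.transition'
  t_fac := D.transition'_comp_snd
  cocycle := D.transition'_cocycle
  f_open := D.isOpenImmersion_f

/-- The inclusion of the chart `U i` into the glued scheme. -/
def ι (i : J) : D.U i ⟶ D.glueData.glued :=
  D.glueData.ι i

instance (i : J) : IsOpenImmersion (D.ι i) :=
  D.glueData.ι_isOpenImmersion i

theorem exists_ι_apply_eq (x : D.glueData.glued) : ∃ i y, D.ι i y = x :=
  D.glueData.ι_jointly_surjective x

theorem comp_ι_eq_comp_ι_iff {T : Scheme.{u}} {i j : J} (p : T ⟶ D.U i) (q : T ⟶ D.U j) :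
    p ≫ D.ι i = q ≫ D.ι j ↔ OverlapRel D.f D.g i j p q := by
  refine ⟨fun h => ?_, ?_⟩
  · let c : PullbackCone (D.ι i) (D.ι j) := PullbackCone.mk p q h
    let hlim := D.glueData.vPullbackConeIsLimit i j
    refine ⟨hlim.lift c, hlim.fac c WalkingCospan.left, ?_⟩
    rw [← transition_comp_f]
    exact hlim.fac c WalkingCospan.right
  · rintro ⟨r, rfl, rfl⟩
    rw [Category.assoc, Category.assoc, ← transition_comp_f, Category.assoc]
    exact congrArg (r ≫ ·) (D.glueData.glue_condition i j).symm

theorem exists_ι_comp_eq {Y : Scheme.{u}} (h : ∀ i, D.U i ⟶ Y)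
    (hh : ∀ i j, D.f i j ≫ h i = D.g i j ≫ h j) :
    ∃ k : D.glueData.glued ⟶ Y, ∀ i, D.ι i ≫ k = h i := by
  have hglue : ∀ i j, D.f i j ≫ h i = (D.transition i j ≫ D.f j i) ≫ h j := fun i j => by
    rw [transition_comp_f, hh]
  exact ⟨Multicoequalizer.desc D.glueData.diagram Y h fun ij => hglue ij.1 ij.2,
    fun _ => Multicoequalizer.π_desc _ _ _ _ _⟩

end GluingRelation

end Glue

section Sheaf

variable {A : Type u} [CommRing A]

/-- A functor on `A`-algebras is a sheaf for the Zariski topology: for finitely many elements of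
`B` that generate the unit ideal, the elements of `H(B)` are the families of elements over the
localizations of `B` that agree over every `A`-algebra to which two of these localizations map. -/
structure IsZariskiSheaf (H : CommAlgCat.{u} A ⥤ Type u) : Prop where
  ext : ∀ (B : CommAlgCat.{u} A) (s : Finset B), Ideal.span (s : Set B) = ⊤ →
    ∀ x y : H.obj B, (∀ f ∈ s, H.map (awayHom B f) x = H.map (awayHom B f) y) → x = y
  glue : ∀ (B : CommAlgCat.{u} A) (s : Finset B), Ideal.span (s : Set B) = ⊤ →
    ∀ x : (f : s) → H.obj (CommAlgCat.of A (Localization.Away f.1)),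
      (∀ (f g : s) (C : CommAlgCat.{u} A) (χ : CommAlgCat.of A (Localization.Away f.1) ⟶ C)
        (χ' : CommAlgCat.of A (Localization.Away g.1) ⟶ C),
        awayHom B f.1 ≫ χ = awayHom B g.1 ≫ χ' → H.map χ (x f) = H.map χ' (x g)) →
      ∃ y : H.obj B, ∀ f : s, H.map (awayHom B f.1) y = x f

/-- The elements `h i ∈ H(K i)` cover the functor `H` locally for the Zariski topology. -/
def IsLocalCover {ι : Type*} (H : CommAlgCat.{u} A ⥤ Type u) (K : ι → CommAlgCat.{u} A)
    (h : ∀ i, H.obj (K i)) : Prop :=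
  ∀ (B : CommAlgCat.{u} A) (x : H.obj B) (p : PrimeSpectrum B), ∃ f : B, f ∉ p.asIdeal ∧
    ∃ (i : ι) (ψ : K i ⟶ CommAlgCat.of A (Localization.Away f)),
      H.map (awayHom B f) x = H.map ψ (h i)

theorem exists_finset_of_forall_prime {B : Type*} [CommRing B] {P : B → Prop}
    (h : ∀ p : PrimeSpectrum B, ∃ f : B, f ∉ p.asIdeal ∧ P f) :
    ∃ s : Finset B, Ideal.span (s : Set B) = ⊤ ∧ ∀ f ∈ s, P f := by
  have hspan : Ideal.span {f | P f} = ⊤ := by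
    rw [← Subtype.range_val (s := {f | P f})]
    refine span_range_eq_top fun p => ?_
    obtain ⟨f, hfp, hf⟩ := h p
    exact ⟨⟨f, hf⟩, hfp⟩
  obtain ⟨s, hs, hspan⟩ := (Ideal.span_eq_top_iff_finite _).1 hspan
  exact ⟨s, hspan, fun f hf => hs hf⟩

theorem exists_awayHom_comp_eq {B C : CommAlgCat.{u} A} (k : B ⟶ C) (f : B)
    (hk : IsUnit (k.hom f)) :
    ∃ χ : CommAlgCat.of A (Localization.Away f) ⟶ C, awayHom B f ≫ χ = k :=
  ⟨CommAlgCat.ofHom (IsLocalization.Away.liftAlgHom f hk),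
    CommAlgCat.hom_ext (AlgHom.ext fun b => IsLocalization.Away.lift_eq f hk b)⟩

theorem map_map_apply {D : Type*} [Category* D] (H : D ⥤ Type u) {B C E : D} (φ : B ⟶ C)
    (χ : C ⟶ E) (x : H.obj B) : H.map χ (H.map φ x) = H.map (φ ≫ χ) x := by
  simp

variable {ι : Type*} {P H : CommAlgCat.{u} A ⥤ Type u} {K : ι → CommAlgCat.{u} A}
  {p : ∀ i, P.obj (K i)} {h : ∀ i, H.obj (K i)} {B C : CommAlgCat.{u} A}

theorem IsZariskiSheaf.eq_iff_forall_map_away (hH : IsZariskiSheaf H) (φ : B ⟶ C) {s : Finset B}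
    (hs : Ideal.span (s : Set B) = ⊤) (u v : H.obj C) :
    u = v ↔ ∀ f ∈ s, H.map (awayHom C (φ.hom f)) u = H.map (awayHom C (φ.hom f)) v := by
  classical
  refine ⟨fun huv f _ => by rw [huv], fun huv => hH.ext C (s.image φ.hom) ?_ u v fun c hc => ?_⟩
  · have hmap := congrArg (Ideal.map (φ.hom : B →+* C)) hs
    rw [Ideal.map_span, Ideal.map_top] at hmap
    rwa [Finset.coe_image]
  · obtain ⟨f, hf, rfl⟩ := Finset.mem_image.1 hc
    exact huv f hf

/-- The elements `x ∈ P(B)` and `y ∈ H(B)` correspond to each other with respect to the local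
coverings `p` and `h`. -/
def Corresponds (p : ∀ i, P.obj (K i)) (h : ∀ i, H.obj (K i)) (x : P.obj B) (y : H.obj B) :
    Prop :=
  ∀ (C : CommAlgCat.{u} A) (φ : B ⟶ C) (i : ι) (ψ : K i ⟶ C),
    P.map φ x = P.map ψ (p i) ↔ H.map φ y = H.map ψ (h i)

namespace Corresponds

theorem map {x : P.obj B} {y : H.obj B} (hxy : Corresponds p h x y) (φ : B ⟶ C) :
    Corresponds p h (P.map φ x) (H.map φ y) := by
  intro D χ i ψ
  rw [map_map_apply, map_map_apply]
  exact hxy D _ i ψ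

theorem symm {x : P.obj B} {y : H.obj B} (hxy : Corresponds p h x y) : Corresponds h p y x :=
  fun C φ i ψ => (hxy C φ i ψ).symm

theorem right_unique (hH : IsZariskiSheaf H) (hp : IsLocalCover P K p) {x : P.obj B}
    {y y' : H.obj B} (hy : Corresponds p h x y) (hy' : Corresponds p h x y') : y = y' := by
  obtain ⟨s, hs, hsf⟩ := exists_finset_of_forall_prime (hp B x)
  refine hH.ext B s hs y y' fun f hf => ?_
  obtain ⟨i, ψ, hψ⟩ := hsf f hf
  rw [(hy _ _ i ψ).1 hψ, (hy' _ _ i ψ).1 hψ]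

theorem of_away (hP : IsZariskiSheaf P) (hH : IsZariskiSheaf H) {s : Finset B}
    (hs : Ideal.span (s : Set B) = ⊤) {x : P.obj B} {y : H.obj B}
    (hxy : ∀ f ∈ s, Corresponds p h (P.map (awayHom B f) x) (H.map (awayHom B f) y)) :
    Corresponds p h x y := by
  intro C φ i ψ
  rw [hP.eq_iff_forall_map_away φ hs, hH.eq_iff_forall_map_away φ hs]
  refine forall₂_congr fun f hf => ?_
  obtain ⟨χ, hχ⟩ := exists_awayHom_comp_eq (φ ≫ awayHom C (φ.hom f)) f
    (IsLocalization.Away.algebraMap_isUnit (φ.hom f))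
  have hC := hxy f hf _ χ i (ψ ≫ awayHom C (φ.hom f))
  rwa [map_map_apply, map_map_apply, hχ, ← map_map_apply, ← map_map_apply, ← map_map_apply,
    ← map_map_apply] at hC

end Corresponds

variable (hP : IsZariskiSheaf P) (hH : IsZariskiSheaf H) (hp : IsLocalCover P K p)
  (hrel : ∀ (i j : ι) (C : CommAlgCat.{u} A) (ψ : K i ⟶ C) (ψ' : K j ⟶ C),
    P.map ψ (p i) = P.map ψ' (p j) ↔ H.map ψ (h i) = H.map ψ' (h j))

include hP hH hp hrel

theorem exists_corresponds (x : P.obj B) : ∃ y : H.obj B, Corresponds p h x y := by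
  obtain ⟨s, hs, hsf⟩ := exists_finset_of_forall_prime (hp B x)
  choose i ψ hψ using fun f : s => hsf f.1 f.2
  have hagree : ∀ (f g : s) (C : CommAlgCat.{u} A)
      (χ : CommAlgCat.of A (Localization.Away f.1) ⟶ C)
      (χ' : CommAlgCat.of A (Localization.Away g.1) ⟶ C),
      awayHom B f.1 ≫ χ = awayHom B g.1 ≫ χ' →
        H.map χ (H.map (ψ f) (h (i f))) = H.map χ' (H.map (ψ g) (h (i g))) := by
    intro f g C χ χ' hχ
    rw [map_map_apply, map_map_apply, ← hrel, ← map_map_apply, ← map_map_apply, ← hψ, ← hψ,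
      map_map_apply, map_map_apply, hχ]
  obtain ⟨y, hy⟩ := hH.glue B s hs _ hagree
  refine ⟨y, .of_away hP hH hs fun f hf => ?_⟩
  rw [hψ ⟨f, hf⟩, hy ⟨f, hf⟩]
  exact Corresponds.map (fun C φ j ψ' => hrel _ j C φ ψ') _

theorem nonempty_iso_of_isLocalCover (hh : IsLocalCover H K h) : Nonempty (P ≅ H) := by
  choose y hy using fun (B : CommAlgCat.{u} A) (x : P.obj B) =>
    exists_corresponds hP hH hp hrel x
  let Ψ : P ⟶ H :=
    { app := fun B => ↾(y B)
      naturality := fun B C φ => by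
        ext x
        exact Corresponds.right_unique hH hp (hy C (P.map φ x)) ((hy B x).map φ) }
  have hinj : ∀ B, Function.Injective (y B) := fun B x x' hxx' =>
    Corresponds.right_unique hP hh (hxx' ▸ hy B x).symm (hy B x').symm
  have hsurj : ∀ B, Function.Surjective (y B) := fun B z => by
    obtain ⟨x, hx⟩ := exists_corresponds hH hP hh (fun i j C ψ ψ' => (hrel i j C ψ ψ').symm) z
    exact ⟨x, Corresponds.right_unique hH hp (hy B x) hx.symm⟩
  have : ∀ B, IsIso (Ψ.app B) := fun B => (isIso_iff_bijective _).2 ⟨hinj B, hsurj B⟩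
  have : IsIso Ψ := NatIso.isIso_of_isIso_app Ψ
  exact ⟨asIso Ψ⟩

end Sheaf

/-! ### Functors covered by affine schemes -/

section Representability

open AlgebraicGeometry CategoryTheory.Limits Opposite

variable {A : Type u} [CommRing A]

/-- The morphism of spectra attached to a homomorphism of `A`-algebras. -/
def specHom {B C : CommAlgCat.{u} A} (φ : B ⟶ C) :
    Spec (CommRingCat.of C) ⟶ Spec (CommRingCat.of B) :=
  Spec.map (CommRingCat.ofHom (φ.hom : B →+* C))

/-- The structure morphism of the spectrum of an `A`-algebra. -/
def specStr (B : CommAlgCat.{u} A) : Spec (CommRingCat.of B) ⟶ Spec (CommRingCat.of A) :=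
  Spec.map (CommRingCat.ofHom (algebraMap A B))

theorem specHom_comp_specStr {B C : CommAlgCat.{u} A} (φ : B ⟶ C) :
    specHom φ ≫ specStr B = specStr C := by
  rw [specHom, specStr, specStr, ← Spec.map_comp, ← CommRingCat.ofHom_comp]
  congr 2
  exact RingHom.ext fun a => φ.hom.commutes a

theorem specHom_comp {B C D : CommAlgCat.{u} A} (φ : B ⟶ C) (χ : C ⟶ D) :
    specHom (φ ≫ χ) = specHom χ ≫ specHom φ :=
  Spec.map_comp (CommRingCat.ofHom (φ.hom : B →+* C)) (CommRingCat.ofHom (χ.hom : C →+* D))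

/-- Points of a scheme over `Spec A`, as morphisms over `Spec A`. -/
def pointMk {X : Over (Spec (CommRingCat.of A))} {B : CommAlgCat.{u} A}
    (s : Spec (CommRingCat.of B) ⟶ X.left) (hs : s ≫ X.hom = specStr B) :
    (pointsFunctor X).obj B :=
  (Over.homMk s hs : (algSpec (CommRingCat.of A)).obj (op B) ⟶ X)

/-- The underlying morphism of schemes of a point. -/
def pointLeft {X : Over (Spec (CommRingCat.of A))} {B : CommAlgCat.{u} A}
    (s : (pointsFunctor X).obj B) : Spec (CommRingCat.of B) ⟶ X.left :=
  Over.Hom.left (show (algSpec (CommRingCat.of A)).obj (op B) ⟶ X from s)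

variable {X : Over (Spec (CommRingCat.of A))} {B C : CommAlgCat.{u} A}

theorem pointLeft_comp_hom (s : (pointsFunctor X).obj B) : pointLeft s ≫ X.hom = specStr B :=
  Over.w (show (algSpec (CommRingCat.of A)).obj (op B) ⟶ X from s)

theorem pointLeft_injective {s t : (pointsFunctor X).obj B} (h : pointLeft s = pointLeft t) :
    s = t :=
  Over.OverMorphism.ext (U := (algSpec (CommRingCat.of A)).obj (op B)) h

theorem pointLeft_map (φ : B ⟶ C) (s : (pointsFunctor X).obj B) :
    pointLeft ((pointsFunctor X).map φ s) = specHom φ ≫ pointLeft s := rfl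

/-- The affine open covering of `Spec B` by the basic open sets of a finite set that generates the
unit ideal. -/
def awayCover (B : CommAlgCat.{u} A) (s : Finset B) (hs : Ideal.span (s : Set B) = ⊤) :
    (Spec (CommRingCat.of B)).OpenCover :=
  (Scheme.affineOpenCoverOfSpanRangeEqTop (R := CommRingCat.of B) (fun f : s => f.1)
    (by simpa using hs)).openCover

theorem exists_specHom_eq (s : Spec (CommRingCat.of C) ⟶ Spec (CommRingCat.of B))
    (hs : s ≫ specStr B = specStr C) : ∃ φ : B ⟶ C, specHom φ = s := by
  obtain ⟨φ, rfl⟩ := Spec.map_surjective s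
  rw [specStr, specStr, ← Spec.map_comp, Spec.map_inj] at hs
  let φ' : B →ₐ[A] C :=
    { φ.hom with commutes' := fun a => RingHom.congr_fun (congrArg CommRingCat.Hom.hom hs) a }
  exact ⟨CommAlgCat.ofHom φ', rfl⟩

theorem pullback_fst_comp_pointLeft_eq {f g : B}
    {x : (pointsFunctor X).obj (CommAlgCat.of A (Localization.Away f))}
    {y : (pointsFunctor X).obj (CommAlgCat.of A (Localization.Away g))}
    (hxy : ∀ (D : CommAlgCat.{u} A) (χ : CommAlgCat.of A (Localization.Away f) ⟶ D)
      (χ' : CommAlgCat.of A (Localization.Away g) ⟶ D), awayHom B f ≫ χ = awayHom B g ≫ χ' →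
      (pointsFunctor X).map χ x = (pointsFunctor X).map χ' y) :
    pullback.fst (specHom (awayHom B f)) (specHom (awayHom B g)) ≫ pointLeft x =
      pullback.snd (specHom (awayHom B f)) (specHom (awayHom B g)) ≫ pointLeft y := by
  let D := CommAlgCat.of A (Localization.Away f ⊗[B] Localization.Away g)
  let χ : CommAlgCat.of A (Localization.Away f) ⟶ D :=
    CommAlgCat.ofHom Algebra.TensorProduct.includeLeft
  let χ' : CommAlgCat.of A (Localization.Away g) ⟶ D :=
    CommAlgCat.ofHom (Algebra.TensorProduct.includeRight.restrictScalars A)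
  have hχ : awayHom B f ≫ χ = awayHom B g ≫ χ' := by
    refine CommAlgCat.hom_ext (AlgHom.ext fun b => ?_)
    change (algebraMap B _ b) ⊗ₜ[B] 1 = 1 ⊗ₜ[B] (algebraMap B _ b)
    rw [Algebra.algebraMap_eq_smul_one, Algebra.algebraMap_eq_smul_one, smul_tmul]
  let θ : pullback (specHom (awayHom B f)) (specHom (awayHom B g)) ≅ Spec (CommRingCat.of D) :=
    pullbackSpecIso B (Localization.Away f) (Localization.Away g)
  have hfst : θ.inv ≫ pullback.fst (specHom (awayHom B f)) (specHom (awayHom B g)) = specHom χ :=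
    pullbackSpecIso_inv_fst ..
  have hsnd : θ.inv ≫ pullback.snd (specHom (awayHom B f)) (specHom (awayHom B g)) = specHom χ' :=
    pullbackSpecIso_inv_snd ..
  rw [← cancel_epi θ.inv, reassoc_of% hfst, reassoc_of% hsnd]
  exact congrArg pointLeft (hxy D χ χ' hχ)

theorem isZariskiSheaf_pointsFunctor (X : Over (Spec (CommRingCat.of A))) :
    IsZariskiSheaf (pointsFunctor X) where
  ext B s hs x y h :=
    pointLeft_injective ((awayCover B s hs).hom_ext _ _ fun f => congrArg pointLeft (h f.1 f.2))
  glue B s hs x hx := by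
    have hcompat := fun f g : s => pullback_fst_comp_pointLeft_eq (hx f g)
    let y := (awayCover B s hs).glueMorphisms (fun f => pointLeft (x f)) hcompat
    have hy : ∀ f : s, specHom (awayHom B f.1) ≫ y = pointLeft (x f) :=
      (awayCover B s hs).ι_glueMorphisms _ hcompat
    refine ⟨pointMk y ((awayCover B s hs).hom_ext _ _ fun f => ?_),
      fun f => pointLeft_injective (hy f)⟩
    change specHom (awayHom B f.1) ≫ y ≫ X.hom = specHom (awayHom B f.1) ≫ specStr B
    rw [reassoc_of% hy f, pointLeft_comp_hom, specHom_comp_specStr]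

theorem range_specHom_awayHom (f : B) :
    Set.range (specHom (awayHom B f)) = (PrimeSpectrum.basicOpen f : Set (PrimeSpectrum B)) :=
  PrimeSpectrum.localization_away_comap_range (Localization.Away f) f

theorem isLocalCover_pointsFunctor {J : Type*} (K : J → CommAlgCat.{u} A)
    (p : ∀ i, (pointsFunctor X).obj (K i)) [∀ i, IsOpenImmersion (pointLeft (p i))]
    (hp : ∀ x : X.left, ∃ i y, pointLeft (p i) y = x) : IsLocalCover (pointsFunctor X) K p := by
  intro B x q
  obtain ⟨i, y, hy⟩ := hp (pointLeft x q)
  let W : (Spec (CommRingCat.of B)).Opens := pointLeft x ⁻¹ᵁ (pointLeft (p i)).opensRange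
  have hqW : q ∈ (W.1 : Set (PrimeSpectrum B)) := ⟨y, hy⟩
  obtain ⟨_, ⟨f, rfl⟩, hqf, hfW⟩ :=
    PrimeSpectrum.isTopologicalBasis_basic_opens.exists_subset_of_mem_open hqW W.isOpen
  have hrange : Set.range (specHom (awayHom B f) ≫ pointLeft x) ⊆
      Set.range (pointLeft (p i)) := by
    rintro _ ⟨z, rfl⟩
    rw [Scheme.Hom.comp_apply]
    have hz : specHom (awayHom B f) z ∈ (PrimeSpectrum.basicOpen f : Set (PrimeSpectrum B)) := by
      rw [← range_specHom_awayHom]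
      exact Set.mem_range_self z
    exact hfW hz
  let l := IsOpenImmersion.lift (pointLeft (p i)) (specHom (awayHom B f) ≫ pointLeft x) hrange
  have hl : l ≫ pointLeft (p i) = specHom (awayHom B f) ≫ pointLeft x :=
    IsOpenImmersion.lift_fac _ _ _
  have hl_str : l ≫ specStr (K i) = specStr (CommAlgCat.of A (Localization.Away f)) := by
    rw [← pointLeft_comp_hom (p i), reassoc_of% hl, pointLeft_comp_hom, specHom_comp_specStr]
  obtain ⟨ψ, hψ⟩ := exists_specHom_eq l hl_str
  exact ⟨f, hqf, i, ψ, pointLeft_injective <| by rw [pointLeft_map, pointLeft_map, hψ, hl]⟩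

end Representability

section Overlap

open AlgebraicGeometry Opposite

variable {A : Type u} [CommRing A]

/-- The morphism `c : T ⟶ Spec C` is universal among the morphisms over `Spec A` from `T` to
spectra of `A`-algebras. -/
def IsAffinization {T : Scheme.{u}} {C : CommAlgCat.{u} A} (c : T ⟶ Spec (CommRingCat.of C)) :
    Prop :=
  ∀ ⦃K : CommAlgCat.{u} A⦄ (p : T ⟶ Spec (CommRingCat.of K)),
    p ≫ specStr K = c ≫ specStr C → ∃! φ : K ⟶ C, c ≫ specHom φ = p

theorem specHom_injective {B C : CommAlgCat.{u} A} {φ ψ : B ⟶ C} (h : specHom φ = specHom ψ) :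
    φ = ψ := by
  have hring := congrArg CommRingCat.Hom.hom (Spec.map_injective h)
  exact CommAlgCat.hom_ext (AlgHom.ext fun b => RingHom.congr_fun hring b)

theorem isAffinization_id (C : CommAlgCat.{u} A) :
    IsAffinization (𝟙 (Spec (CommRingCat.of C))) := by
  intro K p hp
  obtain ⟨φ, rfl⟩ := exists_specHom_eq p (by rw [hp, Category.id_comp])
  exact ⟨φ, Category.id_comp _, fun ψ hψ => specHom_injective (by rw [← hψ, Category.id_comp])⟩

theorem existsUnique_toSpecΓ_comp_specMap {T : Scheme.{u}} {S : CommRingCat.{u}} (p : T ⟶ Spec S) :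
    ∃! φ : S ⟶ Γ(T, ⊤), T.toSpecΓ ≫ Spec.map φ = p := by
  have hbij := (ΓSpec.adjunction.homEquiv T (op S)).bijective
  obtain ⟨φ, hφ, huniq⟩ := hbij.existsUnique p
  exact ⟨φ.unop, hφ, fun ψ hψ => congrArg Quiver.Hom.unop (huniq ψ.op hψ)⟩

theorem exists_isAffinization {T : Scheme.{u}} (t : T ⟶ Spec (CommRingCat.of A)) :
    ∃ (C : CommAlgCat.{u} A) (c : T ⟶ Spec (CommRingCat.of C)),
      c ≫ specStr C = t ∧ IsAffinization c := by
  obtain ⟨τ, hτ, hτ_unique⟩ := existsUnique_toSpecΓ_comp_specMap t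
  let _ : Algebra A Γ(T, ⊤) := τ.hom.toAlgebra
  refine ⟨CommAlgCat.of A Γ(T, ⊤), T.toSpecΓ, hτ, fun K p hp => ?_⟩
  obtain ⟨φ, rfl, hφ_unique⟩ := existsUnique_toSpecΓ_comp_specMap p
  have hφ : CommRingCat.ofHom (algebraMap A K) ≫ φ = τ := by
    refine hτ_unique _ ?_
    change T.toSpecΓ ≫ Spec.map (CommRingCat.ofHom (algebraMap A K) ≫ φ) = t
    rw [Spec.map_comp, ← Category.assoc]
    exact hp.trans hτ
  let φ' : K →ₐ[A] Γ(T, ⊤) :=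
    { φ.hom with commutes' := fun r => RingHom.congr_fun (congrArg CommRingCat.Hom.hom hφ) r }
  refine ⟨CommAlgCat.ofHom φ', rfl, fun ψ hψ => CommAlgCat.hom_ext (AlgHom.ext fun x => ?_)⟩
  exact RingHom.congr_fun (congrArg CommRingCat.Hom.hom (hφ_unique _ hψ)) x

variable {H : CommAlgCat.{u} A ⥤ Type u} {J : Type u} {K : J → CommAlgCat.{u} A}
  {h : ∀ i, H.obj (K i)} {L : J → J → CommAlgCat.{u} A} {a : ∀ i j, K i ⟶ L i j}
  {b : ∀ i j, K j ⟶ L i j}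

theorem OverlapRel.comp_specStr_eq {T : Scheme.{u}} {i j : J}
    {p : T ⟶ Spec (CommRingCat.of (K i))} {q : T ⟶ Spec (CommRingCat.of (K j))}
    (hpq : OverlapRel (fun i j => specHom (a i j)) (fun i j => specHom (b i j)) i j p q) :
    q ≫ specStr (K j) = p ≫ specStr (K i) := by
  obtain ⟨r, rfl, rfl⟩ := hpq
  rw [Category.assoc, Category.assoc, specHom_comp_specStr, specHom_comp_specStr]

section

variable (hL : ∀ (i j : J) (C : CommAlgCat.{u} A) (ψ : K i ⟶ C) (ψ' : K j ⟶ C),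
  (∃ χ : L i j ⟶ C, a i j ≫ χ = ψ ∧ b i j ≫ χ = ψ') ↔ H.map ψ (h i) = H.map ψ' (h j))

include hL

theorem IsAffinization.overlapRel_iff {T : Scheme.{u}} {C : CommAlgCat.{u} A}
    {c : T ⟶ Spec (CommRingCat.of C)} (hc : IsAffinization c) {i j : J} (ψ : K i ⟶ C)
    (ψ' : K j ⟶ C) :
    OverlapRel (fun i j => specHom (a i j)) (fun i j => specHom (b i j)) i j
      (c ≫ specHom ψ) (c ≫ specHom ψ') ↔ H.map ψ (h i) = H.map ψ' (h j) := by
  have hinj : ∀ {B : CommAlgCat.{u} A} (φ φ' : B ⟶ C),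
      c ≫ specHom φ = c ≫ specHom φ' → φ = φ' := fun φ φ' hφ =>
    (hc (c ≫ specHom φ') (by rw [Category.assoc, specHom_comp_specStr])).unique hφ rfl
  rw [← hL]
  constructor
  · rintro ⟨r, hra, hrb⟩
    obtain ⟨χ, rfl, -⟩ := hc r <| by
      rw [← specHom_comp_specStr (a i j), reassoc_of% hra, specHom_comp_specStr]
    rw [Category.assoc, ← specHom_comp] at hra hrb
    exact ⟨χ, hinj _ _ hra, hinj _ _ hrb⟩
  · rintro ⟨χ, rfl, rfl⟩
    exact ⟨c ≫ specHom χ, by rw [specHom_comp, Category.assoc],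
      by rw [specHom_comp, Category.assoc]⟩

/-- The gluing relation of the spectra `Spec (K i)` along `Spec (L i j)`. -/
def gluingRelationOfOverlaps (hopen : ∀ i j, IsOpenImmersion (specHom (a i j))) :
    GluingRelation J where
  U i := Spec (CommRingCat.of (K i))
  V i j := Spec (CommRingCat.of (L i j))
  f i j := specHom (a i j)
  g i j := specHom (b i j)
  isOpenImmersion_f := hopen
  refl i p := by
    obtain ⟨C, c, hct, hc⟩ := exists_isAffinization (p ≫ specStr (K i))
    obtain ⟨ψ, rfl, -⟩ := hc p hct.symm
    exact (hc.overlapRel_iff hL ψ ψ).2 rfl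
  symm {T i j p q} hpq := by
    obtain ⟨C, c, hct, hc⟩ := exists_isAffinization (p ≫ specStr (K i))
    obtain ⟨ψ, rfl, -⟩ := hc p hct.symm
    obtain ⟨ψ', rfl, -⟩ := hc q (hpq.comp_specStr_eq.trans hct.symm)
    exact (hc.overlapRel_iff hL ψ' ψ).2 ((hc.overlapRel_iff hL ψ ψ').1 hpq).symm
  trans {T i j k p q r} hpq hqr := by
    obtain ⟨C, c, hct, hc⟩ := exists_isAffinization (q ≫ specStr (K j))
    obtain ⟨ψ, rfl, -⟩ := hc p (hpq.comp_specStr_eq.symm.trans hct.symm)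
    obtain ⟨ψ', rfl, -⟩ := hc q hct.symm
    obtain ⟨ψ'', rfl, -⟩ := hc r (hqr.comp_specStr_eq.trans hct.symm)
    exact (hc.overlapRel_iff hL ψ ψ'').2 <|
      ((hc.overlapRel_iff hL ψ ψ').1 hpq).trans ((hc.overlapRel_iff hL ψ' ψ'').1 hqr)

theorem isRepresentableByScheme_of_overlaps (hH : IsZariskiSheaf H) (hcov : IsLocalCover H K h)
    (hopen : ∀ i j, IsOpenImmersion (specHom (a i j))) : IsRepresentableByScheme H := by
  let D := gluingRelationOfOverlaps hL hopen
  obtain ⟨k, hk⟩ := D.exists_ι_comp_eq (fun i => specStr (K i)) fun i j =>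
    (specHom_comp_specStr (a i j)).trans (specHom_comp_specStr (b i j)).symm
  let X : Over (Spec (CommRingCat.of A)) := Over.mk k
  let p : ∀ i, (pointsFunctor X).obj (K i) := fun i => pointMk (D.ι i) (hk i)
  have hp : ∀ i, IsOpenImmersion (pointLeft (p i)) := fun i => inferInstanceAs
    (IsOpenImmersion (D.ι i))
  refine ⟨X, nonempty_iso_of_isLocalCover (isZariskiSheaf_pointsFunctor X) hH
    (isLocalCover_pointsFunctor K p D.exists_ι_apply_eq) (fun i j C ψ ψ' => ?_) hcov⟩
  have hspec := (isAffinization_id C).overlapRel_iff hL ψ ψ'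
  rw [Category.id_comp, Category.id_comp] at hspec
  rw [← hspec]
  exact Iff.trans ⟨congrArg pointLeft, pointLeft_injective⟩
    (D.comp_ι_eq_comp_ι_iff (specHom ψ) (specHom ψ'))

end

theorem isRepresentableByScheme_of_corepresentableBy (hH : IsZariskiSheaf H)
    {G : J → Subfunctor H}
    (hcov : ∀ (B : CommAlgCat.{u} A) (x : H.obj B) (p : PrimeSpectrum B),
      ∃ f : B, f ∉ p.asIdeal ∧ ∃ i,
        H.map (awayHom B f) x ∈ (G i).obj (CommAlgCat.of A (Localization.Away f)))
    (r : ∀ i, (G i).toFunctor.CorepresentableBy (K i)) (d : ∀ i, J → K i)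
    (hd : ∀ (i j : J) (C : CommAlgCat.{u} A) (ψ : K i ⟶ C),
      ((r i).homEquiv ψ).1 ∈ (G j).obj C ↔ IsUnit (ψ.hom (d i j))) :
    IsRepresentableByScheme H := by
  let h : ∀ i, H.obj (K i) := fun i => ((r i).homEquiv (𝟙 _)).1
  have hmap : ∀ {i : J} {C : CommAlgCat.{u} A} (ψ : K i ⟶ C),
      H.map ψ (h i) = ((r i).homEquiv ψ).1 := fun {i _} ψ =>
    congrArg Subtype.val ((r i).homEquiv_eq ψ).symm
  have hinj : ∀ {i : J} {C : CommAlgCat.{u} A} {ψ ψ' : K i ⟶ C},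
      H.map ψ (h i) = H.map ψ' (h i) → ψ = ψ' := fun {i _ ψ ψ'} hψ =>
    (r i).homEquiv.injective (Subtype.ext (by rwa [hmap, hmap] at hψ))
  have hsurj : ∀ {i : J} {C : CommAlgCat.{u} A} {x : H.obj C}, x ∈ (G i).obj C →
      ∃ ψ : K i ⟶ C, H.map ψ (h i) = x := fun {i _ x} hx =>
    ⟨(r i).homEquiv.symm ⟨x, hx⟩, (hmap _).trans <|
      congrArg Subtype.val ((r i).homEquiv.apply_symm_apply ⟨x, hx⟩)⟩
  let L : J → J → CommAlgCat.{u} A := fun i j => CommAlgCat.of A (Localization.Away (d i j))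
  let a : ∀ i j, K i ⟶ L i j := fun i j => awayHom (K i) (d i j)
  have ha : ∀ i j, H.map (a i j) (h i) ∈ (G j).obj (L i j) := fun i j => by
    rw [hmap, hd]
    exact IsLocalization.Away.algebraMap_isUnit (d i j)
  choose b hb using fun i j => hsurj (ha i j)
  refine isRepresentableByScheme_of_overlaps (h := h) (a := a) (b := b)
    (fun i j C ψ ψ' => ⟨?_, fun hψ => ?_⟩) hH (fun B x p => ?_) fun i j => ?_
  · rintro ⟨χ, rfl, rfl⟩
    rw [← map_map_apply, ← map_map_apply, hb]
  · have hunit : IsUnit (ψ.hom (d i j)) := by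
      rw [← hd, ← hmap, hψ, hmap]
      exact ((r j).homEquiv ψ').2
    obtain ⟨χ, rfl⟩ := exists_awayHom_comp_eq ψ (d i j) hunit
    exact ⟨χ, rfl, hinj (by rw [← map_map_apply, hb, map_map_apply, hψ])⟩
  · obtain ⟨f, hfp, i, hi⟩ := hcov B x p
    obtain ⟨ψ, hψ⟩ := hsurj hi
    exact ⟨f, hfp, i, ψ, hψ.symm⟩
  · exact Scheme.isOpenImmersion_SpecMap_localizationAway (R := CommRingCat.of (K i)) (d i j)

end Overlap

/-! ### Representability of the Hilbert functor -/

section HilbSheaf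

variable {A : Type u} [CommRing A] {R : Type u} [CommRing R] [Algebra A R] {n : ℕ}

theorem ideal_le_of_map_away_le {B : Type*} [CommRing B] [Algebra A B] {s : Set B}
    (hs : Ideal.span s = ⊤) {I J : Ideal (B ⊗[A] R)}
    (h : ∀ f ∈ s, I.map (baseMap R (IsScalarTower.toAlgHom A B (Localization.Away f))) ≤
      J.map (baseMap R (IsScalarTower.toAlgHom A B (Localization.Away f)))) : I ≤ J := by
  intro z hz
  refine Submodule.mem_of_span_eq_top_of_smul_pow_mem (J.restrictScalars B) s hs z fun f => ?_
  exact (mem_map_baseMap_away_iff f.1 J z).1 (h f.1 f.2 (Ideal.mem_map_of_mem _ hz))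

theorem baseMap_comp_apply {B C D : Type*} [CommRing B] [CommRing C] [CommRing D] [Algebra A B]
    [Algebra A C] [Algebra A D] (φ : B →ₐ[A] C) (χ : C →ₐ[A] D) (z : B ⊗[A] R) :
    baseMap R χ (baseMap R φ z) = baseMap R (χ.comp φ) z := by
  rw [baseMap, baseMap, ← AlgHom.comp_apply, ← Algebra.TensorProduct.map_comp, AlgHom.comp_id]

theorem exists_pow_smul_mem_iInf {B S ι : Type*} [CommRing B] [CommRing S] [Algebra B S] [Finite ι]
    {I : ι → Ideal S} {f : B} {z : S} (h : ∀ i, ∃ k : ℕ, f ^ k • z ∈ I i) :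
    ∃ k : ℕ, f ^ k • z ∈ ⨅ i, I i := by
  have hev : ∀ᶠ k : ℕ in Filter.atTop, ∀ i, f ^ k • z ∈ I i := by
    refine Filter.eventually_all.2 fun i => ?_
    obtain ⟨m, hm⟩ := h i
    filter_upwards [Filter.eventually_ge_atTop m] with k hk
    rw [← Nat.sub_add_cancel hk, pow_add, mul_smul]
    exact Submodule.smul_of_tower_mem (I i) _ hm
  exact hev.exists.imp fun k hk => (Submodule.mem_iInf I).2 hk

section IdealGluing

variable {B : Type u} [CommRing B] [Algebra A B]

theorem exists_pow_smul_mem_comap_away {f g : B} {I : Ideal (Localization.Away f ⊗[A] R)}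
    {I' : Ideal (Localization.Away g ⊗[A] R)}
    (hI : ∀ (C : Type u) [CommRing C] [Algebra A C] (χ : Localization.Away f →ₐ[A] C)
      (χ' : Localization.Away g →ₐ[A] C),
      χ.comp (IsScalarTower.toAlgHom A B _) = χ'.comp (IsScalarTower.toAlgHom A B _) →
      I.map (baseMap R χ) = I'.map (baseMap R χ')) {z : B ⊗[A] R}
    (hz : baseMap R (IsScalarTower.toAlgHom A B (Localization.Away f)) z ∈ I) :
    ∃ k : ℕ, f ^ k • z ∈
      I'.comap (baseMap R (IsScalarTower.toAlgHom A B (Localization.Away g))) := by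
  let ρ := IsScalarTower.toAlgHom A B (Localization.Away f)
  let ρ' := IsScalarTower.toAlgHom A B (Localization.Away g)
  let χ' := IsScalarTower.toAlgHom A (Localization.Away g) (Localization.Away (ρ' f))
  have hunit : IsUnit (χ'.comp ρ' f) := IsLocalization.Away.algebraMap_isUnit (ρ' f)
  obtain ⟨χ, hχ⟩ := exists_awayHom_comp_eq (CommAlgCat.ofHom (χ'.comp ρ')) f hunit
  replace hχ : χ.hom.comp ρ = χ'.comp ρ' := congrArg CommAlgCat.Hom.hom hχ
  have hmem : baseMap R χ' (baseMap R ρ' z) ∈ I'.map (baseMap R χ') := by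
    rw [baseMap_comp_apply, ← hχ, ← baseMap_comp_apply, ← hI _ χ.hom χ' hχ]
    exact Ideal.mem_map_of_mem _ hz
  obtain ⟨k, hk⟩ := (mem_map_baseMap_away_iff (ρ' f) I' (baseMap R ρ' z)).1 hmem
  refine ⟨k, ?_⟩
  rwa [Ideal.mem_comap, baseMap_smul, map_pow]

theorem exists_ideal_map_away_eq {s : Finset B} (I : (f : s) → Ideal (Localization.Away f.1 ⊗[A] R))
    (hI : ∀ (f g : s) (C : Type u) [CommRing C] [Algebra A C] (χ : Localization.Away f.1 →ₐ[A] C)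
      (χ' : Localization.Away g.1 →ₐ[A] C),
      χ.comp (IsScalarTower.toAlgHom A B _) = χ'.comp (IsScalarTower.toAlgHom A B _) →
      (I f).map (baseMap R χ) = (I g).map (baseMap R χ')) :
    ∃ J : Ideal (B ⊗[A] R), ∀ f : s,
      J.map (baseMap R (IsScalarTower.toAlgHom A B (Localization.Away f.1))) = I f := by
  let ρ : ∀ f : s, B →ₐ[A] Localization.Away f.1 := fun f => IsScalarTower.toAlgHom A B _
  let J : Ideal (B ⊗[A] R) := ⨅ f : s, (I f).comap (baseMap R (ρ f))
  refine ⟨J, fun f => le_antisymm (Ideal.map_le_iff_le_comap.2 (iInf_le _ f)) fun y hy => ?_⟩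
  obtain ⟨k, z, hz⟩ := exists_baseMap_eq_pow_smul f.1 y
  have hzI : baseMap R (ρ f) z ∈ I f := by
    rw [hz]
    exact Submodule.smul_of_tower_mem (I f) _ hy
  have hzJ : baseMap R (ρ f) z ∈ J.map (baseMap R (ρ f)) :=
    (mem_map_baseMap_away_iff f.1 J z).2 <|
      exists_pow_smul_mem_iInf fun g => exists_pow_smul_mem_comap_away (hI f g) hzI
  have hunit : IsUnit (algebraMap B (Localization.Away f.1) f.1 ^ k) :=
    (IsLocalization.Away.algebraMap_isUnit f.1).pow k
  rwa [hz, Algebra.smul_def, Ideal.unit_mul_mem_iff_mem _ (hunit.map _)] at hzJ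

end IdealGluing

theorem isZariskiSheaf_hilb : IsZariskiSheaf (hilb A R n) where
  ext B s hs x y h := by
    have hmap : ∀ f ∈ s, (HilbPoint.ideal x).map
        (baseMap R (IsScalarTower.toAlgHom A B (Localization.Away f))) = (HilbPoint.ideal y).map
        (baseMap R (IsScalarTower.toAlgHom A B (Localization.Away f))) := fun f hf =>
      congrArg HilbPoint.ideal (h f hf)
    exact HilbPoint.ext (le_antisymm (ideal_le_of_map_away_le hs fun f hf => (hmap f hf).le)
      (ideal_le_of_map_away_le hs fun f hf => (hmap f hf).ge))
  glue B s hs x hx := by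
    let x' : ∀ f : s, HilbPoint (A := A) R n (Localization.Away f.1) := x
    obtain ⟨J, hJ⟩ := exists_ideal_map_away_eq (fun f => (x' f).ideal) fun f g C _ _ χ χ' hχ =>
      congrArg HilbPoint.ideal (hx f g (CommAlgCat.of A C) (CommAlgCat.ofHom χ)
        (CommAlgCat.ofHom χ') (CommAlgCat.hom_ext hχ))
    refine ⟨(⟨J, .of_away fun p => ?_⟩ : HilbPoint (A := A) R n B), fun f => HilbPoint.ext (hJ f)⟩
    obtain ⟨f, hf, hfp⟩ : ∃ f ∈ s, f ∉ p.asIdeal := by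
      by_contra! hcon
      exact p.isPrime.ne_top (top_le_iff.1 (hs ▸ Ideal.span_le.2 hcon))
    have hlf := (x' ⟨f, hf⟩).isLocallyFree
    rw [← hJ ⟨f, hf⟩] at hlf
    obtain ⟨e⟩ := nonempty_quotient_equiv (A := A) R (C := Localization.Away f) J
    exact ⟨f, hfp, hlf.congr e.symm.toLinearEquiv⟩

end HilbSheaf

section HilbOverlap

variable {A : Type u} [CommRing A] {R F : Type u} [CommRing R] [Algebra A R] [AddCommGroup F]
  [Module A F] [Module.Free A F] [Module.Finite A F] {n : ℕ}

theorem surjective_iff_isUnit_det {C : Type*} [CommRing C] {P : Type*} [AddCommGroup P]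
    [Module C P] [Module.Free C P] [Module.Finite C P] (f : P →ₗ[C] P) :
    Function.Surjective f ↔ IsUnit (LinearMap.det f) := by
  rw [← LinearMap.isUnit_iff_isUnit_det, Module.End.isUnit_iff]
  exact ⟨fun h => ⟨OrzechProperty.injective_of_surjective_endomorphism f h, h⟩, fun h => h.2⟩

theorem surjective_sectionMap_map_iff {B C : Type u} [CommRing B] [Algebra A B]
    [CommRing C] [Algebra A C] {e : F} {β : F →ₗ[A] R} {μ : R →ₐ[A] B ⊗[A] Module.End A F}
    (hμ : IsCompatible e β μ) {x : HilbPoint (A := A) R n B} (hx : x.IsClassOf (family e μ))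
    (γ : F →ₗ[A] R) (φ : B →ₐ[A] C) :
    Function.Surjective (sectionMap γ C (x.map φ).ideal) ↔
      IsUnit (φ (LinearMap.det (family e μ ∘ₗ γ.baseChange B))) := by
  let _ : Algebra B C := φ.toRingHom.toAlgebra
  have : IsScalarTower A B C := IsScalarTower.of_algebraMap_eq fun r => (φ.commutes r).symm
  let c := AlgebraTensorModule.cancelBaseChange A B C C F
  have hfamily : family e (changeBase φ μ) = c.toLinearMap ∘ₗ quotMap C (family e μ) :=
    family_changeBase e μ
  have hbase : quotMap C (family e μ) ∘ₗ γ.baseChange C =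
      (family e μ ∘ₗ γ.baseChange B).baseChange C ∘ₗ c.symm.toLinearMap :=
    AlgebraTensorModule.ext fun y f => by simp [quotMap_tmul, c]
  rw [sectionMap_surjective_iff γ _ _ (hμ.changeBase φ).isSectionHom.surjective
    (hx.map hμ.isSectionHom.surjective φ), surjective_iff_isUnit_det, hfamily,
    LinearMap.comp_assoc, hbase, LinearMap.det_conj, LinearMap.det_baseChange]
  rfl

theorem isRepresentableByScheme_hilb (b : Module.Basis (Fin n) A F) (i : Fin n) :
    IsRepresentableByScheme (hilb A R n) := by
  let π : SymmetricAlgebra A R →ₐ[A] R := SymmetricAlgebra.lift LinearMap.id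
  have hπ : Function.Surjective π := fun r =>
    ⟨SymmetricAlgebra.ι A R r, SymmetricAlgebra.lift_ι_apply _ r⟩
  choose Φ hΦ using fun β : {β : F →ₗ[A] R // β (b i) = 1} =>
    exists_iso_hilbSection (n := n) π hπ b β.2
  let r := fun β => Functor.corepresentableByEquiv.symm (Φ β)
  have hcov := (isOpenCovering_hilbSection (R := R) b i).2
  refine isRepresentableByScheme_of_corepresentableBy isZariskiSheaf_hilb hcov r
    (fun β γ => LinearMap.det (universalFamily π hπ (b i) β.1 ∘ₗ γ.1.baseChange _))
    fun β γ C ψ => ?_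
  rw [(r β).homEquiv_eq ψ]
  exact surjective_sectionMap_map_iff (isCompatible_univHom π hπ (b i) β.1) (hΦ β) γ.1 ψ.hom

end HilbOverlap

end

end HilbertPoints

theorem theorem5p4 {A : Type u} [CommRing A] {R : Type u} [CommRing R] [Algebra A R]
    {F : Type u} [AddCommGroup F] [Module A F] [Module.Free A F] [Module.Finite A F]
    (n : ℕ) (e : F) (he : ∃ (b : Module.Basis (Fin n) A F) (i : Fin n), b i = e) :
    HilbertPoints.IsRepresentableByScheme (HilbertPoints.hilb A R n) ∧
    HilbertPoints.IsOpenCovering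
      (fun β : {β : F →ₗ[A] R // β e = 1} => HilbertPoints.hilbSection n β.1) ∧
    ∀ (M : Type u) [AddCommGroup M] [Module A M] (π : SymmetricAlgebra A M →ₐ[A] R)
      (hπ : Function.Surjective π) (β : F →ₗ[A] R), β e = 1 →
      HilbertPoints.IsSectionHom e β (HilbertPoints.universalFamily π hπ e β) ∧
      ∃ Φ : coyoneda.obj (Opposite.op
            (CommAlgCat.of A (HilbertPoints.AlgHRSection π hπ e β))) ≅
          (HilbertPoints.hilbSection n β).toFunctor,
        HilbertPoints.HilbPoint.IsClassOf
          (Φ.hom.app (CommAlgCat.of A (HilbertPoints.AlgHRSection π hπ e β)) (𝟙 _)).1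
          (HilbertPoints.universalFamily π hπ e β) := by
  obtain ⟨b, i, rfl⟩ := he
  exact ⟨HilbertPoints.isRepresentableByScheme_hilb b i,
    HilbertPoints.isOpenCovering_hilbSection b i, fun M _ _ π hπ β hβ =>
      ⟨(HilbertPoints.isCompatible_univHom π hπ (b i) β).isSectionHom,
        HilbertPoints.exists_iso_hilbSection π hπ b hβ⟩⟩
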